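/- Let $u_0,u_1$ be $C^\infty$ vector fields on the torus $\mathbb T^2=\mathbb R^2/\mathbb Z^2$ that are transversal, i.e. $u_0(x)$ and $u_1(x)$ span $\mathbb R^2$ for every $x\in\mathbb T^2$. Let $\Phi_i^t$ be the flow of $u_i$, $\Psi_i^t=\Phi_i^{-t}$ its inverse, and let $D\Psi_i^t(x)$ be the differential of $\Psi_i^t$ at $x$. Let $\lambda>0$, and let $(X_t,A_t)_{t\ge 0}$ be the Markov process on $\mathbb T^2\times\{0,1\}$ in which $X$ follows the flow $\Phi_{A_t}$ and $A$ switches between $0$ and $1$ after independent waiting times that are exponential with rate $\lambda$. Let $\mathsf P^t_{x,i}$ be the law of $(X_t,A_t)$ started at $(x,i)$. Let $\mu$ be an invariant probability measure, that is, $$\mu(E\times\{i\})=\sum_{j\in\{0,1\}}\int_{\mathbb T^2}\mathsf P^t_{x,j}(E\times\{i\})\,\mu(dx\times\{j\})$$ for all Borel $E\subset\mathbb T^2$, $i\in\{0,1\}$, $t\ge 0$, and write $\mu_i(E)=\mu(E\times\{i\})$. For integrable $h:\mathbb T^2\to\mathbb R$ define $$Qh(x)=\int_0^\infty\!\!\int_0^\infty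 \lambda^2e^{-\lambda(s+t)}\,J_{(s,t)}(x)\,h\big(\Psi_1^s(\Psi_0^t x)\big)\,ds\,dt,\qquad J_{(s,t)}(x)=\det\!\big(D\Psi_1^s(\Psi_0^t x)\,D\Psi_0^t(x)\big).$$ Then $\mu_0$ and $\mu_1$ are absolutely continuous with respect to Lebesgue measure, and any densities $\rho_0,\rho_1$ of them satisfy, for Lebesgue-almost every $x\in\mathbb T^2$, $$\rho_i(x)=\int_0^\infty\lambda e^{-\lambda t}\,\det D\Psi_i^t(x)\,\rho_{1-i}(\Psi_i^t x)\,dt\quad (i=0,1)\qquad\text{and}\qquad \rho_0(x)=Q\rho_0(x),$$ where the integrals converge absolutely for almost every $x$. -/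

import Mathlib

open MeasureTheory ProbabilityTheory Set
open scoped ContDiff

noncomputable section

namespace Switching

/-- The plane `ℝ²`, the universal cover of the torus. -/
abbrev Plane : Type := Fin 2 → ℝ

/-- The torus `𝕋² = ℝ²/ℤ²`; its `volume` is Lebesgue measure (total mass one). -/
abbrev Torus : Type := UnitAddTorus (Fin 2)

/-- The covering projection `ℝ² → 𝕋²`. -/
def proj (x : Plane) : Torus := fun k => (x k : UnitAddCircle)

/-- The representative in `[0,1)²` of a point of the torus. -/
def rep (x : Torus) : Plane := fun k => (AddCircle.equivIco (1 : ℝ) 0 (x k) : ℝ)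

/-- A vector field on the torus is smooth if its `ℤ²`-periodic lift to `ℝ²` is `C^∞`. -/
def SmoothField (v : Torus → Plane) : Prop :=
  ContDiff ℝ ∞ (fun x : Plane => v (proj x))

/-- The flow on `ℝ²` of the lift of the vector field `v`: the value at time `t` of the solution,
defined on all of `ℝ`, of `ẋ = v(x)`, `x(0) = x`.  For a smooth field on the torus this solution
exists and is unique, so that the value in the `else` branch plays no role. -/
def coverFlow (v : Torus → Plane) (t : ℝ) (x : Plane) : Plane :=
  open Classical in
  if h : ∃ γ : ℝ → Plane, γ 0 = x ∧ IsIntegralCurve γ (fun _ y => v (proj y))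
  then h.choose t else x

/-- The flow `Φ^t` on the torus. -/
def flow (v : Torus → Plane) (t : ℝ) (x : Torus) : Torus :=
  proj (coverFlow v t (rep x))

/-- The inverse flow `Ψ^t = Φ^{-t}`. -/
def invFlow (v : Torus → Plane) (t : ℝ) (x : Torus) : Torus :=
  flow v (-t) x

/-- The differential `DΨ^t(x)` with respect to `x`, in the coordinates of `ℝ²`. -/
def dInvFlow (v : Torus → Plane) (t : ℝ) (x : Torus) : Plane →L[ℝ] Plane :=
  fderiv ℝ (coverFlow v (-t)) (rep x)

/-- The two vector fields are transversal: they span the tangent plane at every point. -/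
def Transversal (u : Fin 2 → Torus → Plane) : Prop :=
  ∀ x : Torus, Submodule.span ℝ {u 0 x, u 1 x} = ⊤

/-! ### The switching process

The waiting times between switches are `τ 0, τ 1, …`, independent and exponential with rate `lam`.
The index `1 - i : Fin 2` is the index other than `i`. -/

/-- The law of the sequence of waiting times. -/
def waitingLaw (lam : ℝ) : Measure (ℕ → ℝ) :=
  Measure.infinitePi (fun _ : ℕ => expMeasure lam)

/-- The time of the `n`-th switch (`0` for `n = 0`). -/
def switchTime (τ : ℕ → ℝ) (n : ℕ) : ℝ := ∑ k ∈ Finset.range n, τ k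

/-- The position and the driving index right after the `n`-th switch. -/
def postSwitch (u : Fin 2 → Torus → Plane) (z : Torus × Fin 2) (τ : ℕ → ℝ) : ℕ → Torus × Fin 2
  | 0 => z
  | n + 1 =>
    let y := postSwitch u z τ n
    (flow (u y.2) (τ n) y.1, 1 - y.2)

/-- The number of switches that have occurred up to time `t`. -/
def switchCount (τ : ℕ → ℝ) (t : ℝ) : ℕ := {n : ℕ | switchTime τ (n + 1) ≤ t}.ncard

/-- The state `(X_t, A_t)` of the process started at `z`. -/
def state (u : Fin 2 → Torus → Plane) (z : Torus × Fin 2) (t : ℝ) (τ : ℕ → ℝ) : Torus × Fin 2 :=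
  let n := switchCount τ t
  let y := postSwitch u z τ n
  (flow (u y.2) (t - switchTime τ n) y.1, y.2)

/-- The transition probability `P^t_z(B)`. -/
def transProb (u : Fin 2 → Torus → Plane) (lam t : ℝ) (z : Torus × Fin 2)
    (B : Set (Torus × Fin 2)) : ENNReal :=
  waitingLaw lam {τ | state u z t τ ∈ B}

/-- The component `E ↦ μ(E × {i})` of a measure on `𝕋² × {0,1}`. -/
def component (μ : Measure (Torus × Fin 2)) (i : Fin 2) : Measure Torus :=
  (μ.restrict (univ ×ˢ {i})).map Prod.fst

/-- `μ` is an invariant (probability) measure of the Markov semigroup of `(X, A)`. -/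
def IsInvariant (u : Fin 2 → Torus → Plane) (lam : ℝ) (μ : Measure (Torus × Fin 2)) : Prop :=
  IsProbabilityMeasure μ ∧
    ∀ t : ℝ, 0 ≤ t → ∀ E : Set Torus, MeasurableSet E → ∀ i : Fin 2,
      μ (E ×ˢ {i}) = ∑ j : Fin 2, ∫⁻ x, transProb u lam t (x, j) (E ×ˢ {i}) ∂(component μ j)

/-- `ρ` is a density of the finite measure `ν` with respect to Lebesgue measure. -/
def IsDensity (ν : Measure Torus) (ρ : Torus → ℝ) : Prop :=
  Integrable ρ volume ∧ ∀ E : Set Torus, MeasurableSet E → ν.real E = ∫ x in E, ρ x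

/-! ### Transfer operators -/

/-- The integrand `λ e^{-λt} det DΨ_i^t(x) h(Ψ_i^t x)` of the one-switch transfer operator. -/
def oneSwitchIntegrand (u : Fin 2 → Torus → Plane) (lam : ℝ) (i : Fin 2) (h : Torus → ℝ)
    (x : Torus) (t : ℝ) : ℝ :=
  lam * Real.exp (-lam * t) * (dInvFlow (u i) t x).det * h (invFlow (u i) t x)

/-- `Ψ^{(s,t)} = Ψ_1^s ∘ Ψ_0^t`. -/
def invFlow₂ (u : Fin 2 → Torus → Plane) (s t : ℝ) (x : Torus) : Torus :=
  invFlow (u 1) s (invFlow (u 0) t x)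

/-- The Jacobian `J_{(s,t)}(x) = det (DΨ_1^s(Ψ_0^t x) DΨ_0^t(x))`. -/
def jac (u : Fin 2 → Torus → Plane) (s t : ℝ) (x : Torus) : ℝ :=
  ((dInvFlow (u 1) s (invFlow (u 0) t x)).comp (dInvFlow (u 0) t x)).det

/-- The integrand `λ² e^{-λ(s+t)} J_{(s,t)}(x) h(Ψ^{(s,t)} x)` of `Q`, at `p = (s, t)`. -/
def QIntegrand (u : Fin 2 → Torus → Plane) (lam : ℝ) (h : Torus → ℝ) (x : Torus)
    (p : ℝ × ℝ) : ℝ :=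
  lam ^ 2 * Real.exp (-lam * (p.1 + p.2)) * jac u p.1 p.2 x * h (invFlow₂ u p.1 p.2 x)

/-- The two-switch transfer operator `Q`. -/
def Q (u : Fin 2 → Torus → Plane) (lam : ℝ) (h : Torus → ℝ) (x : Torus) : ℝ :=
  ∫ p in Ioi (0 : ℝ) ×ˢ Ioi (0 : ℝ), QIntegrand u lam h x p

end Switching

end

noncomputable section

namespace Switching

/-! ### Flows of bounded Lipschitz fields on a normed space -/

section AbstractFlow

open scoped NNReal Manifold Topology

variable {E : Type*} [NormedAddCommGroup E] [NormedSpace ℝ E]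

/-! Condition on the last switch before time `t`. Since $\mu$ is invariant at time `t` and at the
time `s` of that switch, it satisfies $\mu_i(E)=e^{-\lambda t}\mu_i(\Phi_i^{-t}E)+\int_0^t\lambda
e^{-\lambda(t-s)}\mu_{1-i}(\Phi_i^{-(t-s)}E)\,ds$ (`IsInvariant.component_eq`). As $t\to\infty$ the
first term vanishes, leaving the one-switch identity $\mu_i(E)=\int_0^\infty\lambda e^{-\lambda
r}\mu_{1-i}(\Phi_i^{-r}E)\,dr$ (`IsInvariant.component_eq_lintegral`). Everything else follows from
it.

Absolute continuity: iterating the identity once writes $\mu_i(N)$ as an average over $(r,s)$ of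
$\mu_i\{x:\Phi_i^r\Phi_{1-i}^s x\in N\}$. For fixed $x$ the map $(r,s)\mapsto\Phi_i^r\Phi_{1-i}^s x$
has invertible differential by transversality, so it pulls null sets back to null sets
(`ae_flow_flow_notMem`); Fubini concludes.

Densities: the change of variables $y=\Phi_i^r x$ (`SmoothField.lintegral_flow`) together with
Tonelli turns the identity into the equation for $\rho_i$, and inserting the equation for $\rho_1$
into that for $\rho_0$ gives $\rho_0=Q\rho_0$. The Jacobians carry no absolute value because flow
maps preserve orientation. All integrands are a.e. nonnegative, so the computation runs in `ℝ≥0∞`,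
and absolute convergence follows from finiteness of the left-hand side. -/

/-- A bounded, globally Lipschitz `C¹` field with a uniform quadratic Taylor estimate. -/
structure TameField (V : E → E) (K : ℝ≥0) (M C : ℝ) : Prop where
  contDiff : ContDiff ℝ 1 V
  norm_le : ∀ x, ‖V x‖ ≤ M
  lipschitz : LipschitzWith K V
  taylor : ∀ x y, ‖V y - V x - fderiv ℝ V x (y - x)‖ ≤ C * ‖y - x‖ ^ 2

/-- `φ` is the global flow of the field `V`. -/
structure IsGlobalFlow (V : E → E) (φ : ℝ → E → E) : Prop where
  zero : ∀ x, φ 0 x = x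
  hasDerivAt : ∀ x t, HasDerivAt (fun t => φ t x) (V (φ t x)) t

variable {V : E → E} {φ : ℝ → E → E} {K : ℝ≥0} {M C : ℝ}

lemma TameField.neg (h : TameField V K M C) : TameField (fun x => -V x) K M C where
  contDiff := h.contDiff.neg
  norm_le x := by simpa using h.norm_le x
  lipschitz := h.lipschitz.neg
  taylor x y := by
    have := h.taylor x y
    rw [← norm_neg] at this
    have hd : fderiv ℝ (fun x => -V x) x = -fderiv ℝ V x := fderiv_fun_neg
    have he : -V y - -V x - (-fderiv ℝ V x) (y - x) =
        -(V y - V x - fderiv ℝ V x (y - x)) := by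
      rw [neg_apply]; abel
    rwa [hd, he]

/-- Time reversal, which reduces claims about negative times to positive ones. -/
lemma IsGlobalFlow.neg (hφ : IsGlobalFlow V φ) :
    IsGlobalFlow (fun x => -V x) (fun t => φ (-t)) where
  zero x := by simpa using hφ.zero x
  hasDerivAt x t := by
    have := (hφ.hasDerivAt x (-t)).scomp t (hasDerivAt_neg t)
    simpa [Function.comp_def] using this

/-- The bounds on the field are global, so Picard–Lindelöf gives a solution on the same interval
`(-1, 1)` from every starting point, and such a uniform existence time implies global existence. -/
lemma TameField.exists_isIntegralCurve [CompleteSpace E] (h : TameField V K M C) (x : E) :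
    ∃ γ : ℝ → E, γ 0 = x ∧ IsIntegralCurve γ (fun _ y => V y) := by
  have hM : 0 ≤ M := (norm_nonneg _).trans (h.norm_le 0)
  have key : ∀ x : E, ∃ γ : ℝ → E, γ 0 = x ∧
      IsMIntegralCurveOn (I := 𝓘(ℝ, E)) γ V (Ioo (-1 : ℝ) 1) := by
    intro x
    have hP : IsPicardLindelof (fun _ : ℝ => V) (tmin := -1) (tmax := 1) ⟨0, by simp⟩ x
        ⟨M, hM⟩ 0 ⟨M, hM⟩ K := by
      refine IsPicardLindelof.of_time_independent (fun y _ => h.norm_le y)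
        h.lipschitz.lipschitzOnWith ?_
      simp
    obtain ⟨γ, h0, hγ⟩ := hP.exists_eq_forall_mem_Icc_hasDerivWithinAt₀
    refine ⟨γ, h0, fun t ht => ?_⟩
    have := (hγ t (Ioo_subset_Icc_self ht)).mono Ioo_subset_Icc_self
    exact this.hasFDerivWithinAt.hasMFDerivWithinAt
  have hC : ContMDiff 𝓘(ℝ, E) 𝓘(ℝ, E).tangent 1
      (fun x => (⟨x, V x⟩ : TangentBundle 𝓘(ℝ, E) E)) := by
    exact contMDiff_vectorSpace_iff_contDiff.2 h.contDiff
  obtain ⟨γ, h0, hγ⟩ := exists_isMIntegralCurve_of_isMIntegralCurveOn hC one_pos key x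
  refine ⟨γ, h0, fun t => ?_⟩
  have hd : HasFDerivAt γ ((1 : ℝ →L[ℝ] ℝ).smulRight (V (γ t))) t :=
    hasMFDerivAt_iff_hasFDerivAt.1 (hγ t)
  exact hd.hasDerivAt.congr_deriv (one_smul ℝ (V (γ t)))

namespace IsGlobalFlow

lemma continuous_time (hφ : IsGlobalFlow V φ) (x : E) : Continuous (fun t => φ t x) :=
  continuous_iff_continuousAt.2 fun t => (hφ.hasDerivAt x t).continuousAt

lemma eq_of_isIntegralCurve (hV : LipschitzWith K V) (hφ : IsGlobalFlow V φ) {γ : ℝ → E}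
    (hγ : ∀ t, HasDerivAt γ (V (γ t)) t) (t : ℝ) : γ t = φ t (γ 0) := by
  have := ODE_solution_unique_univ (v := fun _ => V) (s := fun _ => univ) (K := K) (t₀ := 0)
    (f := γ) (g := fun t => φ t (γ 0)) (fun _ => hV.lipschitzOnWith)
    (fun t => ⟨hγ t, trivial⟩) (fun t => ⟨hφ.hasDerivAt _ t, trivial⟩) (hφ.zero _).symm
  exact congrFun this t

lemma add (hV : LipschitzWith K V) (hφ : IsGlobalFlow V φ) (s t : ℝ) (x : E) :
    φ (s + t) x = φ s (φ t x) := by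
  have := hφ.eq_of_isIntegralCurve hV (γ := fun s => φ (s + t) x)
    (fun s => by simpa using (hφ.hasDerivAt x (s + t)).comp_add_const s t) s
  simpa using this

lemma neg_apply (hV : LipschitzWith K V) (hφ : IsGlobalFlow V φ) (t : ℝ) (x : E) :
    φ (-t) (φ t x) = x := by
  rw [← hφ.add hV, neg_add_cancel, hφ.zero]

lemma dist_le_of_nonneg (hV : LipschitzWith K V) (hφ : IsGlobalFlow V φ) {t : ℝ} (ht : 0 ≤ t)
    (x y : E) : dist (φ t x) (φ t y) ≤ dist x y * Real.exp (K * t) := by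
  have := dist_le_of_trajectories_ODE (v := fun _ => V) (a := 0) (b := t) (δ := dist x y)
    (f := fun t => φ t x) (g := fun t => φ t y) (fun _ => hV)
    (hφ.continuous_time x).continuousOn (fun t _ => (hφ.hasDerivAt x t).hasDerivWithinAt)
    (hφ.continuous_time y).continuousOn (fun t _ => (hφ.hasDerivAt y t).hasDerivWithinAt)
    (by simp [hφ.zero]) t ⟨ht, le_rfl⟩
  simpa using this

lemma dist_le (hV : LipschitzWith K V) (hφ : IsGlobalFlow V φ) (t : ℝ)
    (x y : E) : dist (φ t x) (φ t y) ≤ dist x y * Real.exp (K * |t|) := by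
  rcases le_total 0 t with ht | ht
  · rw [abs_of_nonneg ht]; exact hφ.dist_le_of_nonneg hV ht x y
  · rw [abs_of_nonpos ht]
    simpa using hφ.neg.dist_le_of_nonneg hV.neg (neg_nonneg.2 ht) x y

lemma continuous_uncurry (hV : LipschitzWith K V) (hφ : IsGlobalFlow V φ) :
    Continuous (fun p : ℝ × E => φ p.1 p.2) := by
  rw [continuous_iff_continuousAt]
  rintro ⟨t, x⟩
  rw [ContinuousAt, tendsto_iff_dist_tendsto_zero]
  have hlim : Filter.Tendsto (fun p : ℝ × E =>
      dist p.2 x * Real.exp (K * |p.1|) + dist (φ p.1 x) (φ t x)) (𝓝 (t, x)) (𝓝 0) := by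
    have hc : Continuous (fun p : ℝ × E =>
        dist p.2 x * Real.exp (K * |p.1|) + dist (φ p.1 x) (φ t x)) := by
      have h2 : Continuous fun p : ℝ × E => φ p.1 x :=
        (hφ.continuous_time x).comp (continuous_fst (X := ℝ) (Y := E))
      exact ((continuous_snd.dist continuous_const).mul (by fun_prop)).add
        (h2.dist continuous_const)
    simpa using hc.tendsto (t, x)
  refine squeeze_zero (fun _ => dist_nonneg) (fun p => ?_) hlim
  exact (dist_triangle _ (φ p.1 x) _).trans (by gcongr; exact hφ.dist_le hV _ _ _)

end IsGlobalFlow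

/-! ### Differentiability of the flow through the variational equation -/

lemma TameField.norm_fderiv_le (h : TameField V K M C) (x : E) : ‖fderiv ℝ V x‖ ≤ K :=
  norm_fderiv_le_of_lipschitz ℝ h.lipschitz

/-- Short time solution of the variational equation along an orbit. -/
lemma TameField.exists_variational [CompleteSpace E] (h : TameField V K M C)
    (hφ : IsGlobalFlow V φ) (x : E) :
    ∃ Y : ℝ → E →L[ℝ] E, Y 0 = ContinuousLinearMap.id ℝ E ∧
      ∀ t ∈ Icc (0 : ℝ) (1 / (2 * K + 1)), HasDerivWithinAt Y
        ((fderiv ℝ V (φ t x)).comp (Y t)) (Icc (0 : ℝ) (1 / (2 * K + 1))) t := by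
  have hε : (0 : ℝ) ≤ 1 / (2 * K + 1) := by positivity
  -- On the unit ball around the identity `‖Y‖ ≤ 2`, so the right-hand side is at most `2 * K`. The
  -- solution stays in that ball as long as `2 * K * t ≤ 1`; the `+ 1` covers `K = 0`.
  have hP : IsPicardLindelof (fun (t : ℝ) (Y : E →L[ℝ] E) => (fderiv ℝ V (φ t x)).comp Y)
      (tmin := 0) (tmax := 1 / (2 * K + 1)) ⟨0, by simpa using hε⟩
      (ContinuousLinearMap.id ℝ E) 1 0 (2 * K) K := by
    constructor
    · intro t _
      refine LipschitzOnWith.of_dist_le_mul fun A _ B _ => ?_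
      rw [dist_eq_norm, dist_eq_norm, ← ContinuousLinearMap.comp_sub]
      exact (ContinuousLinearMap.opNorm_comp_le _ _).trans
        (by gcongr; exact h.norm_fderiv_le _)
    · intro Y _
      have h1 : Continuous (fderiv ℝ V) := h.contDiff.continuous_fderiv (by simp)
      have h2 := h1.comp (hφ.continuous_time x)
      exact (h2.clm_comp continuous_const).continuousOn
    · intro t _ Y hY
      have hY' : ‖Y‖ ≤ 2 := by
        have h1 : ‖Y - ContinuousLinearMap.id ℝ E‖ ≤ 1 := by
          simpa [dist_eq_norm] using hY
        have h2 := ContinuousLinearMap.norm_id_le (𝕜 := ℝ) (E := E)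
        calc ‖Y‖ = ‖(Y - ContinuousLinearMap.id ℝ E) + ContinuousLinearMap.id ℝ E‖ := by simp
          _ ≤ 1 + 1 := (norm_add_le _ _).trans (add_le_add h1 h2)
          _ = 2 := by norm_num
      calc _ ≤ ‖fderiv ℝ V (φ t x)‖ * ‖Y‖ := ContinuousLinearMap.opNorm_comp_le _ _
        _ ≤ K * 2 := by gcongr; exact h.norm_fderiv_le _
        _ = _ := by push_cast; ring
    · have : max (1 / (2 * (K : ℝ) + 1) - 0) (0 - 0) = 1 / (2 * K + 1) := by
        rw [sub_zero, sub_zero, max_eq_left hε]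
      simp only [this]
      push_cast
      rw [mul_one_div, sub_zero, div_le_one (by positivity)]
      linarith
  exact hP.exists_eq_forall_mem_Icc_hasDerivWithinAt₀

/-- The curve `φ s x + Y s k` solves the equation up to a Taylor error of order `‖k‖ ^ 2`. Grönwall
compares it with the true orbit of `x + k`, and a quadratic error is `o(k)`. -/
lemma TameField.hasFDerivAt_flow_of_variational (h : TameField V K M C)
    (hφ : IsGlobalFlow V φ) (x : E) {ε : ℝ} {Y : ℝ → E →L[ℝ] E}
    (hY0 : Y 0 = ContinuousLinearMap.id ℝ E)
    (hY : ∀ t ∈ Icc (0 : ℝ) ε, HasDerivWithinAt Y ((fderiv ℝ V (φ t x)).comp (Y t)) (Icc 0 ε) t)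
    {t : ℝ} (ht : t ∈ Icc (0 : ℝ) ε) : HasFDerivAt (φ t) (Y t) x := by
  have hYc : ContinuousOn Y (Icc 0 ε) := fun t ht => (hY t ht).continuousWithinAt
  obtain ⟨B, hB⟩ := isCompact_Icc.exists_bound_of_continuousOn hYc
  have key : ∀ k : E, ‖φ t (x + k) - φ t x - Y t k‖ ≤
      (gronwallBound 0 K (|C| * B ^ 2) t) * ‖k‖ ^ 2 := by
    intro k
    have hg : ∀ s ∈ Icc 0 ε, HasDerivWithinAt (fun s => φ s x + Y s k)
        (V (φ s x) + (fderiv ℝ V (φ s x)) (Y s k)) (Icc 0 ε) s := fun s hs =>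
      (hφ.hasDerivAt x s).hasDerivWithinAt.add
        ((hY s hs).clm_apply (hasDerivWithinAt_const s _ k) |>.congr_deriv (by simp))
    have := dist_le_of_approx_trajectories_ODE (v := fun _ => V) (a := 0) (b := ε)
      (f := fun s => φ s (x + k)) (f' := fun s => V (φ s (x + k)))
      (g := fun s => φ s x + Y s k)
      (g' := fun s => V (φ s x) + (fderiv ℝ V (φ s x)) (Y s k))
      (εf := 0) (εg := |C| * B ^ 2 * ‖k‖ ^ 2) (δ := 0) (fun _ => h.lipschitz)
      (hφ.continuous_time _).continuousOn (fun s _ => (hφ.hasDerivAt _ s).hasDerivWithinAt)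
      (by simp) (fun s hs => (hg s hs).continuousWithinAt)
      (fun s hs => (hg s (Ico_subset_Icc_self hs)).mono_of_mem_nhdsWithin
        (Icc_mem_nhdsGE_of_mem hs))
      (fun s hs => by
        have hs' := Ico_subset_Icc_self hs
        rw [dist_comm, dist_eq_norm, ← sub_sub]
        have h1 := h.taylor (φ s x) (φ s x + Y s k)
        rw [add_sub_cancel_left] at h1
        refine h1.trans ?_
        have h2 : ‖Y s k‖ ≤ B * ‖k‖ := ((Y s).le_opNorm k).trans (by gcongr; exact hB s hs')
        calc C * ‖Y s k‖ ^ 2 ≤ |C| * (B * ‖k‖) ^ 2 := by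
              gcongr; exact le_abs_self C
          _ = _ := by ring)
      (by simp [hφ.zero, hY0]) t ht
    rw [dist_eq_norm, ← sub_sub, sub_zero, zero_add] at this
    refine this.trans (le_of_eq ?_)
    -- With zero initial error the Grönwall bound is linear in the defect, so `‖k‖ ^ 2` factors out.
    by_cases hK : (K : ℝ) = 0
    · rw [hK, gronwallBound_K0, gronwallBound_K0]; ring
    · rw [gronwallBound_of_K_ne_0 hK, gronwallBound_of_K_ne_0 hK]; ring
  rw [hasFDerivAt_iff_isLittleO_nhds_zero]
  refine (Asymptotics.IsBigO.of_bound' (g := fun k : E => (gronwallBound 0 K (|C| * B ^ 2) t) *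
    ‖k‖ ^ 2) (Filter.Eventually.of_forall fun k => ?_)).trans_isLittleO ?_
  · exact (key k).trans (le_abs_self _)
  · exact (Asymptotics.isLittleO_norm_pow_id one_lt_two).const_mul_left _

lemma TameField.differentiableAt_flow_short [CompleteSpace E] (h : TameField V K M C)
    (hφ : IsGlobalFlow V φ) (x : E) {t : ℝ} (ht : |t| ≤ 1 / (2 * K + 1)) :
    DifferentiableAt ℝ (φ t) x := by
  rcases le_total 0 t with h0 | h0
  · obtain ⟨Y, hY0, hY⟩ := h.exists_variational hφ x
    rw [abs_of_nonneg h0] at ht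
    exact (h.hasFDerivAt_flow_of_variational hφ x hY0 hY ⟨h0, ht⟩).differentiableAt
  · obtain ⟨Y, hY0, hY⟩ := h.neg.exists_variational hφ.neg x
    rw [abs_of_nonpos h0] at ht
    simpa using (h.neg.hasFDerivAt_flow_of_variational hφ.neg x hY0 hY
      ⟨neg_nonneg.2 h0, ht⟩).differentiableAt

lemma det_clm_comp {F : Type*} [NormedAddCommGroup F] [NormedSpace ℝ F]
    (A B : F →L[ℝ] F) : (A.comp B).det = A.det * B.det :=
  LinearMap.det_comp A.toLinearMap B.toLinearMap

lemma det_fderiv_ne_zero_of_leftInverse {f g : E → E} {x : E}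
    (hgf : Function.LeftInverse g f) (hf : DifferentiableAt ℝ f x)
    (hg : DifferentiableAt ℝ g (f x)) : (fderiv ℝ f x).det ≠ 0 := by
  intro h0
  have h1 : (fderiv ℝ g (f x)).comp (fderiv ℝ f x) = ContinuousLinearMap.id ℝ E := by
    rw [← fderiv_comp x hg hf]
    have : g ∘ f = id := funext hgf
    rw [this, fderiv_id]
  have h2 := congrArg ContinuousLinearMap.det h1
  rw [det_clm_comp, h0, mul_zero] at h2
  exact zero_ne_one (h2.trans LinearMap.det_id)

/-- The determinant equals `1` at time zero, varies continuously, and never vanishes because `φ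
(-s)` is a differentiable inverse of `φ s`; the intermediate value theorem fixes its sign. -/
lemma TameField.det_fderiv_flow_pos_short [CompleteSpace E] [FiniteDimensional ℝ E] (h : TameField V K M C)
    (hφ : IsGlobalFlow V φ) (x : E) {t : ℝ} (ht : |t| ≤ 1 / (2 * K + 1)) :
    0 < (fderiv ℝ (φ t) x).det := by
  wlog h0 : 0 ≤ t generalizing V φ t
  · have := this h.neg hφ.neg (t := -t) (by simpa using ht) (by linarith)
    simpa using this
  rw [abs_of_nonneg h0] at ht
  set ε : ℝ := 1 / (2 * K + 1)
  obtain ⟨Y, hY0, hY⟩ := h.exists_variational hφ x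
  have hD : ∀ s ∈ Icc 0 ε, fderiv ℝ (φ s) x = Y s := fun s hs =>
    (h.hasFDerivAt_flow_of_variational hφ x hY0 hY hs).fderiv
  have hYc : ContinuousOn (fun s => (Y s).det) (Icc 0 ε) :=
    ContinuousLinearMap.continuous_det.comp_continuousOn
      fun s hs => (hY s hs).continuousWithinAt
  have hne : ∀ s ∈ Icc 0 ε, (Y s).det ≠ 0 := fun s hs => by
    rw [← hD s hs]
    have hs' : |s| ≤ ε := by rw [abs_of_nonneg hs.1]; exact hs.2
    exact det_fderiv_ne_zero_of_leftInverse (g := φ (-s))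
      (fun y => hφ.neg_apply h.lipschitz s y) (h.differentiableAt_flow_short hφ x hs')
      (h.differentiableAt_flow_short hφ _ (by rwa [abs_neg]))
  rw [hD t ⟨h0, ht⟩]
  by_contra hneg
  have hε : 0 ≤ ε := h0.trans ht
  have h1 : (Y 0).det = 1 := by rw [hY0]; exact LinearMap.det_id
  obtain ⟨s, hs, hs0⟩ := isPreconnected_Icc.intermediate_value (s := Icc 0 ε)
    (a := t) (b := 0) ⟨h0, ht⟩ ⟨le_rfl, hε⟩ hYc (show (0 : ℝ) ∈ Icc _ _ from
      ⟨not_lt.1 hneg, by rw [h1]; norm_num⟩)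
  exact hne s hs hs0

/-- The time `t` maps of the flow are differentiable and preserve orientation. -/
lemma TameField.differentiableAt_flow_and_det_pos [CompleteSpace E] [FiniteDimensional ℝ E]
    (h : TameField V K M C) (hφ : IsGlobalFlow V φ) (t : ℝ) (x : E) :
    DifferentiableAt ℝ (φ t) x ∧ 0 < (fderiv ℝ (φ t) x).det := by
  -- Cut `t` into `n` steps, each short enough for the local result, and compose.
  obtain ⟨n, hn⟩ := exists_nat_gt (|t| * (2 * K + 1))
  have hn0 : (0 : ℝ) < n := lt_of_le_of_lt (by positivity) hn
  set s : ℝ := t / n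
  have hs : |s| ≤ 1 / (2 * K + 1) := by
    rw [abs_div, abs_of_pos hn0, div_le_div_iff₀ hn0 (by positivity)]
    linarith
  have key : ∀ m : ℕ, ∀ x, DifferentiableAt ℝ (φ (m * s)) x ∧
      0 < (fderiv ℝ (φ (m * s)) x).det := by
    intro m
    induction m with
    | zero =>
      intro x
      have : φ ((0 : ℕ) * s) = id := by funext y; simpa using hφ.zero y
      rw [this, fderiv_id]
      refine ⟨differentiableAt_id, ?_⟩
      rw [show (ContinuousLinearMap.id ℝ E).det = 1 from LinearMap.det_id]
      exact one_pos
    | succ m ih =>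
      intro x
      have : φ ((m + 1 : ℕ) * s) = φ s ∘ φ (m * s) := by
        funext y
        rw [Function.comp_apply, ← hφ.add h.lipschitz]
        congr 1
        push_cast; ring
      rw [this]
      have hd := h.differentiableAt_flow_short hφ (φ (m * s) x) hs
      refine ⟨hd.comp x (ih x).1, ?_⟩
      rw [fderiv_comp x hd (ih x).1, det_clm_comp]
      exact mul_pos (h.det_fderiv_flow_pos_short hφ _ hs) (ih x).2
  have := key n x
  rwa [show (n : ℝ) * s = t from mul_div_cancel₀ t hn0.ne'] at this

/-- Near `(0, x)` the curve `φ s (x + k) - s • V x` has small velocity by continuity of the flow, so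
the mean value inequality suffices. The group law carries this to other times. -/
lemma TameField.hasFDerivAt_flow_zero (h : TameField V K M C) (hφ : IsGlobalFlow V φ) (x : E) :
    HasFDerivAt (fun p : ℝ × E => φ p.1 p.2)
      ((ContinuousLinearMap.fst ℝ ℝ E).smulRight (V x) + ContinuousLinearMap.snd ℝ ℝ E)
      (0, x) := by
  have hc : Continuous (fun p : ℝ × E => V (φ p.1 p.2) - V x) :=
    (h.contDiff.continuous.comp (hφ.continuous_uncurry h.lipschitz)).sub continuous_const
  rw [hasFDerivAt_iff_isLittleO_nhds_zero, Asymptotics.isLittleO_iff]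
  intro c hc0
  have hev : ∀ᶠ p : ℝ × E in 𝓝 (0, x), ‖V (φ p.1 p.2) - V x‖ < c := by
    have := (hc.norm.tendsto (0, x))
    simp only [hφ.zero, sub_self, norm_zero] at this
    exact this.eventually (gt_mem_nhds hc0)
  obtain ⟨δ, hδ, hball⟩ := Metric.eventually_nhds_iff_ball.1 hev
  filter_upwards [Metric.ball_mem_nhds (0 : ℝ × E) hδ] with p hp
  rcases p with ⟨r, k⟩
  simp only [mem_ball_zero_iff, Prod.norm_mk, max_lt_iff] at hp
  have hbd : ∀ s ∈ uIcc 0 r, ‖V (φ s (x + k)) - V x‖ ≤ c := by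
    intro s hs
    refine (hball (s, x + k) ?_).le
    rw [mem_ball_iff_norm]
    simp only [Prod.mk_sub_mk, sub_zero, add_sub_cancel_left, Prod.norm_mk, max_lt_iff]
    refine ⟨lt_of_le_of_lt ?_ hp.1, hp.2⟩
    have := abs_sub_left_of_mem_uIcc hs
    simpa using this
  have hmv := (convex_uIcc (0 : ℝ) r).norm_image_sub_le_of_norm_hasDerivWithin_le
    (f := fun s => φ s (x + k) - s • V x) (f' := fun s => V (φ s (x + k)) - V x) (C := c)
    (x := 0) (y := r)
    (fun s _ => ((hφ.hasDerivAt _ s).sub (by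
      simpa using (hasDerivAt_id s).smul_const (V x))).hasDerivWithinAt) hbd
    left_mem_uIcc right_mem_uIcc
  calc _ = ‖φ r (x + k) - r • V x - (φ 0 (x + k) - (0 : ℝ) • V x)‖ := by
        congr 1
        simp [hφ.zero]
        abel
    _ ≤ c * ‖r - 0‖ := hmv
    _ ≤ c * ‖(r, k)‖ := by
        gcongr
        rw [sub_zero]
        exact le_max_left _ _

/-- The joint derivative of a flow in time and space. -/
lemma TameField.hasFDerivAt_flow_uncurry [CompleteSpace E] [FiniteDimensional ℝ E] (h : TameField V K M C)
    (hφ : IsGlobalFlow V φ) (t : ℝ) (x : E) :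
    HasFDerivAt (fun p : ℝ × E => φ p.1 p.2)
      ((ContinuousLinearMap.fst ℝ ℝ E).smulRight (V (φ t x)) +
        (fderiv ℝ (φ t) x).comp (ContinuousLinearMap.snd ℝ ℝ E)) (t, x) := by
  have h1 : HasFDerivAt (fun p : ℝ × E => (p.1 - t, φ t p.2))
      ((ContinuousLinearMap.fst ℝ ℝ E).prod
        ((fderiv ℝ (φ t) x).comp (ContinuousLinearMap.snd ℝ ℝ E))) (t, x) :=
    ((hasFDerivAt_fst).sub_const t).prodMk
      (HasFDerivAt.comp (t, x) (h.differentiableAt_flow_and_det_pos hφ t x).1.hasFDerivAt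
        hasFDerivAt_snd)
  have h0 := h.hasFDerivAt_flow_zero hφ (φ t x)
  have h2 := HasFDerivAt.comp (t, x) (g := fun p : ℝ × E => φ p.1 p.2)
    (f := fun p : ℝ × E => (p.1 - t, φ t p.2)) (by simpa using h0) h1
  have hfun : (fun p : ℝ × E => φ p.1 p.2) =
      (fun p : ℝ × E => φ p.1 p.2) ∘ (fun p : ℝ × E => (p.1 - t, φ t p.2)) := by
    funext p
    simp [← hφ.add h.lipschitz]
  rw [hfun]
  refine h2.congr_fderiv ?_
  ext p <;> simp

/-- A field is invariant under its own flow. -/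
lemma TameField.fderiv_flow_apply [CompleteSpace E] [FiniteDimensional ℝ E] (h : TameField V K M C)
    (hφ : IsGlobalFlow V φ) (t : ℝ) (x : E) : fderiv ℝ (φ t) x (V x) = V (φ t x) := by
  -- Differentiate `φ t (φ s x) = φ (t + s) x` at `s = 0` in two ways.
  have h1 : HasDerivAt (fun s => φ t (φ s x)) (fderiv ℝ (φ t) x (V x)) 0 := by
    have hd := (h.differentiableAt_flow_and_det_pos hφ t x).1.hasFDerivAt
    have hs := hφ.hasDerivAt x 0
    rw [hφ.zero] at hs
    exact HasFDerivAt.comp_hasDerivAt (0 : ℝ) (l := φ t) (by simpa [hφ.zero] using hd) hs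
  have h2 : HasDerivAt (fun s => φ t (φ s x)) (V (φ t x)) 0 := by
    have h3 := (hφ.hasDerivAt x (t + 0)).comp_const_add t 0
    simpa [hφ.add h.lipschitz, hφ.zero] using h3
  exact h1.unique h2

end AbstractFlow

/-! ### The covering of the torus -/

section Covering

open scoped NNReal Topology

/-- The lattice point of the plane with the given integer coordinates. -/
def latticePoint (n : Fin 2 → ℤ) : Plane := fun k => (n k : ℝ)

lemma proj_add_latticePoint (x : Plane) (n : Fin 2 → ℤ) : proj (x + latticePoint n) = proj x := by
  funext k
  simp [proj, latticePoint]

lemma proj_eq_proj_iff {x y : Plane} : proj x = proj y ↔ ∃ n, y = x + latticePoint n := by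
  constructor
  · intro h
    have h1 : ∀ k, ∃ m : ℤ, y k - x k = m := fun k => by
      have h2 : (x k : UnitAddCircle) = y k := congrFun h k
      have h3 : ((y k - x k : ℝ) : UnitAddCircle) = 0 := by
        rw [AddCircle.coe_sub, h2, sub_self]
      obtain ⟨m, hm⟩ := (AddCircle.coe_eq_zero_iff (1 : ℝ)).1 h3
      exact ⟨m, by rw [← hm, zsmul_one]⟩
    choose n hn using h1
    exact ⟨n, funext fun k => by simp [latticePoint, ← hn]⟩
  · rintro ⟨n, rfl⟩
    exact (proj_add_latticePoint x n).symm

lemma continuous_proj : Continuous proj :=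
  continuous_pi fun k => (AddCircle.continuous_mk' 1).comp (continuous_apply k)

lemma proj_rep (x : Torus) : proj (rep x) = x := by
  funext k
  exact (AddCircle.equivIco (1 : ℝ) 0).symm_apply_apply (x k)

lemma rep_mem (x : Torus) (k : Fin 2) : rep x k ∈ Ico (0 : ℝ) 1 := by
  have := (AddCircle.equivIco (1 : ℝ) 0 (x k)).2
  simpa [rep] using this

lemma measurable_rep : Measurable rep :=
  measurable_pi_lambda _ fun k => measurable_subtype_coe.comp
    ((AddCircle.measurableEquivIco (1 : ℝ) 0).measurable.comp (measurable_pi_apply k))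

lemma exists_eq_rep_add (x : Plane) : ∃ n, x = rep (proj x) + latticePoint n :=
  proj_eq_proj_iff.1 (proj_rep (proj x))

lemma exists_bound_of_periodic {F : Type*} [NormedAddCommGroup F] {g : Plane → F}
    (hg : Continuous g) (hp : ∀ x n, g (x + latticePoint n) = g x) :
    ∃ B : ℝ≥0, ∀ x, ‖g x‖ ≤ B := by
  obtain ⟨B, hB⟩ := (isCompact_Icc (a := (0 : Plane)) (b := 1)).exists_bound_of_continuousOn
    hg.continuousOn
  refine ⟨B.toNNReal, fun x => ?_⟩
  obtain ⟨n, hn⟩ := exists_eq_rep_add x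
  rw [hn, hp]
  exact (hB _ ⟨fun k => (rep_mem _ k).1, fun k => (rep_mem _ k).2.le⟩).trans (Real.le_coe_toNNReal B)

variable {v : Torus → Plane}

/-- The lift of a smooth field is tame. -/
lemma SmoothField.exists_tameField (hv : SmoothField v) :
    ∃ (K : ℝ≥0) (M C : ℝ), TameField (fun x => v (proj x)) K M C := by
  set V : Plane → Plane := fun x => v (proj x)
  have hV : ContDiff ℝ ∞ V := hv
  have hp : ∀ x n, V (x + latticePoint n) = V x := fun x n => by
    simp only [V, proj_add_latticePoint]
  have hp1 : ∀ x n, fderiv ℝ V (x + latticePoint n) = fderiv ℝ V x := fun x n => by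
    rw [← fderiv_comp_add_right]
    simp only [hp]
  have hp2 : ∀ x n, fderiv ℝ (fderiv ℝ V) (x + latticePoint n) = fderiv ℝ (fderiv ℝ V) x :=
    fun x n => by
      rw [← fderiv_comp_add_right]
      simp only [hp1]
  have hV1 : ContDiff ℝ ∞ (fderiv ℝ V) := hV.fderiv_right (by simp)
  obtain ⟨M, hM⟩ := exists_bound_of_periodic hV.continuous hp
  obtain ⟨K, hK⟩ := exists_bound_of_periodic hV1.continuous hp1
  -- A bound on the second derivative is a Lipschitz constant for the first, which gives the
  -- quadratic Taylor estimate along segments.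
  obtain ⟨C, hC⟩ := exists_bound_of_periodic (hV1.continuous_fderiv (by simp)) hp2
  have hd : Differentiable ℝ V := hV.differentiable (by simp)
  have hL : LipschitzWith C (fderiv ℝ V) :=
    lipschitzWith_of_nnnorm_fderiv_le (hV1.differentiable (by simp)) hC
  refine ⟨K, M, C, hV.of_le (by norm_cast), hM,
    lipschitzWith_of_nnnorm_fderiv_le hd hK, fun x y => ?_⟩
  have := (convex_segment x y).norm_image_sub_le_of_norm_hasFDerivWithin_le'
    (f := V) (f' := fderiv ℝ V) (φ := fderiv ℝ V x) (C := C * ‖y - x‖)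
    (fun z _ => (hd z).hasFDerivAt.hasFDerivWithinAt)
    (fun z hz => by
      rw [← dist_eq_norm]
      refine (hL.dist_le_mul z x).trans ?_
      gcongr
      rw [dist_eq_norm]
      exact norm_sub_le_of_mem_segment hz)
    (left_mem_segment ℝ x y) (right_mem_segment ℝ x y)
  rwa [mul_assoc, ← sq] at this

lemma SmoothField.isGlobalFlow (hv : SmoothField v) :
    IsGlobalFlow (fun x => v (proj x)) (coverFlow v) := by
  obtain ⟨K, M, C, h⟩ := hv.exists_tameField
  have key : ∀ x, coverFlow v 0 x = x ∧ ∀ t, HasDerivAt (fun t => coverFlow v t x)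
      (v (proj (coverFlow v t x))) t := fun x => by
    have hx : ∃ γ : ℝ → Plane, γ 0 = x ∧ IsIntegralCurve γ (fun _ y => v (proj y)) :=
      h.exists_isIntegralCurve x
    have he : ∀ t, coverFlow v t x = hx.choose t := fun t => by
      simp only [coverFlow, dif_pos hx]
    simp only [he]
    exact ⟨hx.choose_spec.1, hx.choose_spec.2⟩
  exact ⟨fun x => (key x).1, fun x => (key x).2⟩

lemma SmoothField.continuous_coverFlow (hv : SmoothField v) :
    Continuous (fun p : ℝ × Plane => coverFlow v p.1 p.2) := by
  obtain ⟨K, M, C, h⟩ := hv.exists_tameField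
  exact hv.isGlobalFlow.continuous_uncurry h.lipschitz

lemma SmoothField.coverFlow_add (hv : SmoothField v) (s t : ℝ) (x : Plane) :
    coverFlow v (s + t) x = coverFlow v s (coverFlow v t x) := by
  obtain ⟨K, M, C, h⟩ := hv.exists_tameField
  exact hv.isGlobalFlow.add h.lipschitz s t x

lemma SmoothField.differentiableAt_coverFlow (hv : SmoothField v) (t : ℝ) (x : Plane) :
    DifferentiableAt ℝ (coverFlow v t) x := by
  obtain ⟨K, M, C, h⟩ := hv.exists_tameField
  exact (h.differentiableAt_flow_and_det_pos hv.isGlobalFlow t x).1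

lemma SmoothField.det_fderiv_coverFlow_pos (hv : SmoothField v) (t : ℝ) (x : Plane) :
    0 < (fderiv ℝ (coverFlow v t) x).det := by
  obtain ⟨K, M, C, h⟩ := hv.exists_tameField
  exact (h.differentiableAt_flow_and_det_pos hv.isGlobalFlow t x).2

/-- By periodicity of the field, a lattice translate of an orbit is again an orbit; uniqueness
identifies it. -/
lemma SmoothField.coverFlow_add_latticePoint (hv : SmoothField v) (t : ℝ) (x : Plane)
    (n : Fin 2 → ℤ) : coverFlow v t (x + latticePoint n) = coverFlow v t x + latticePoint n := by
  obtain ⟨K, M, C, h⟩ := hv.exists_tameField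
  have := hv.isGlobalFlow.eq_of_isIntegralCurve h.lipschitz
    (γ := fun t => coverFlow v t x + latticePoint n)
    (fun t => by
      rw [proj_add_latticePoint]
      exact (hv.isGlobalFlow.hasDerivAt x t).add_const _) t
  rw [hv.isGlobalFlow.zero] at this
  exact this.symm

/-- Makes the discontinuous choice `rep` harmless: any lift of the point may be used, so identities
for the flow can be checked on the plane. -/
lemma SmoothField.flow_proj (hv : SmoothField v) (t : ℝ) (x : Plane) :
    flow v t (proj x) = proj (coverFlow v t x) := by
  obtain ⟨n, hn⟩ := exists_eq_rep_add x
  rw [flow]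
  nth_rewrite 2 [hn]
  rw [hv.coverFlow_add_latticePoint, proj_add_latticePoint]

lemma SmoothField.flow_invFlow (hv : SmoothField v) (t : ℝ) (x : Torus) :
    flow v t (invFlow v t x) = x := by
  rw [invFlow, ← proj_rep x, hv.flow_proj, hv.flow_proj, ← hv.coverFlow_add, add_neg_cancel,
    hv.isGlobalFlow.zero]

lemma SmoothField.measurable_flow (hv : SmoothField v) :
    Measurable (fun p : ℝ × Torus => flow v p.1 p.2) :=
  continuous_proj.measurable.comp <| hv.continuous_coverFlow.measurable.comp
    (measurable_fst.prodMk (measurable_rep.comp measurable_snd))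

lemma SmoothField.measurable_invFlow (hv : SmoothField v) :
    Measurable (fun p : ℝ × Torus => invFlow v p.1 p.2) :=
  hv.measurable_flow.comp (measurable_fst.neg.prodMk measurable_snd)

lemma SmoothField.dInvFlow_proj (hv : SmoothField v) (t : ℝ) (x : Plane) :
    dInvFlow v t (proj x) = fderiv ℝ (coverFlow v (-t)) x := by
  obtain ⟨n, hn⟩ := exists_eq_rep_add x
  rw [dInvFlow]
  nth_rewrite 2 [hn]
  rw [← fderiv_comp_add_right]
  simp only [hv.coverFlow_add_latticePoint]
  exact (fderiv_add_const _).symm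

lemma SmoothField.det_dInvFlow_pos (hv : SmoothField v) (t : ℝ) (x : Torus) :
    0 < (dInvFlow v t x).det :=
  hv.det_fderiv_coverFlow_pos _ _

lemma SmoothField.measurable_det_dInvFlow (hv : SmoothField v) :
    Measurable (fun p : ℝ × Torus => (dInvFlow v p.1 p.2).det) := by
  have h1 : Measurable fun p : ℝ × Plane => fderiv ℝ (coverFlow v p.1) p.2 :=
    measurable_fderiv_with_param ℝ hv.continuous_coverFlow
  exact ContinuousLinearMap.continuous_det.measurable.comp <| h1.comp
    (measurable_fst.neg.prodMk (measurable_rep.comp measurable_snd))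

lemma jac_eq (u : Fin 2 → Torus → Plane) (s t : ℝ) (x : Torus) :
    jac u s t x = (dInvFlow (u 1) s (invFlow (u 0) t x)).det * (dInvFlow (u 0) t x).det :=
  det_clm_comp _ _

end Covering

/-! ### Lebesgue measure on the torus and the flows -/

section Lebesgue

open scoped NNReal ENNReal Topology

/-- The lattice of integer points as a subgroup of the plane. -/
def lattice : AddSubgroup Plane :=
  AddMonoidHom.range (G := Fin 2 → ℤ)
    { toFun := latticePoint
      map_zero' := by funext k; simp [latticePoint]
      map_add' := fun m n => by funext k; simp [latticePoint] }

instance : Countable lattice := by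
  have : (range latticePoint).Countable := countable_range _
  exact this.to_subtype

lemma proj_vadd (g : lattice) (x : Plane) : proj (g +ᵥ x) = proj x := by
  obtain ⟨_, n, rfl⟩ := g
  have : ((⟨_, n, rfl⟩ : lattice) +ᵥ x : Plane) = x + latticePoint n := add_comm _ _
  rw [this, proj_add_latticePoint]

/-- The half open unit cube. -/
def cube : Set Plane := univ.pi fun _ => Ioc (0 : ℝ) 1

lemma measurableSet_cube : MeasurableSet cube :=
  MeasurableSet.univ_pi fun _ => measurableSet_Ioc

lemma existsUnique_add_mem_cube (x : Plane) : ∃! n, x + latticePoint n ∈ cube := by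
  have h : ∀ k, ∃! n : ℤ, x k + n • (1 : ℝ) ∈ Ioc (0 : ℝ) (0 + 1) := fun k =>
    existsUnique_add_zsmul_mem_Ioc one_pos (x k) 0
  choose n hn hu using h
  refine ⟨n, fun k _ => by simpa [latticePoint] using hn k, fun m hm => funext fun k => ?_⟩
  refine hu k (m k) ?_
  simpa [latticePoint] using hm k trivial

lemma isAddFundamentalDomain_of_existsUnique {S : Set Plane} (hS : MeasurableSet S)
    (h : ∀ x, ∃! n, x + latticePoint n ∈ S) :
    IsAddFundamentalDomain lattice S (volume : Measure Plane) := by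
  refine IsAddFundamentalDomain.mk' hS.nullMeasurableSet fun x => ?_
  obtain ⟨n, hn, hu⟩ := h x
  refine ⟨⟨latticePoint n, n, rfl⟩, ?_, ?_⟩
  · change latticePoint n + x ∈ S
    rwa [add_comm]
  · rintro ⟨_, m, rfl⟩ hm
    have hm' : latticePoint m + x ∈ S := hm
    rw [add_comm] at hm'
    have := hu m hm'
    subst this
    rfl

lemma measurePreserving_proj :
    MeasurePreserving proj ((volume : Measure Plane).restrict cube) volume := by
  have h := measurePreserving_pi (fun _ : Fin 2 => (volume : Measure ℝ).restrict (Ioc 0 (0 + 1)))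
    (fun _ : Fin 2 => (volume : Measure UnitAddCircle))
    (fun _ => AddCircle.measurePreserving_mk 1 0)
  rw [← Measure.restrict_pi_pi] at h
  simp only [zero_add] at h
  exact h

/-- Integration over the torus as integration over any fundamental domain. -/
lemma setLIntegral_proj {S : Set Plane} (hS : MeasurableSet S)
    (h : ∀ x, ∃! n, x + latticePoint n ∈ S) {g : Torus → ℝ≥0∞} (hg : Measurable g) :
    ∫⁻ x in S, g (proj x) = ∫⁻ x, g x := by
  rw [← measurePreserving_proj.lintegral_comp hg]
  exact (isAddFundamentalDomain_of_existsUnique hS h).setLIntegral_eq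
    (isAddFundamentalDomain_of_existsUnique measurableSet_cube existsUnique_add_mem_cube) _
    fun a x => by rw [proj_vadd]

lemma volume_proj_preimage_eq_zero {N : Set Torus} (hN : volume N = 0) :
    volume (proj ⁻¹' N) = 0 := by
  refine (isAddFundamentalDomain_of_existsUnique measurableSet_cube
    existsUnique_add_mem_cube).measure_zero_of_invariant _ (fun a => ?_) ?_
  · ext x
    rw [Set.mem_vadd_set_iff_neg_vadd_mem, mem_preimage, proj_vadd, mem_preimage]
  · have h := measurePreserving_proj.quasiMeasurePreserving.preimage_null hN
    rwa [Measure.restrict_apply' measurableSet_cube] at h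

variable {v w : Torus → Plane}

/-- Change of variables along the flow. -/
lemma SmoothField.lintegral_flow (hv : SmoothField v) (t : ℝ) {g : Torus → ℝ≥0∞}
    (hg : Measurable g) :
    ∫⁻ x, g (flow v t x) = ∫⁻ y, ENNReal.ofReal (dInvFlow v t y).det * g y := by
  have hinv : ∀ s x, coverFlow v s (coverFlow v (-s) x) = x := fun s x => by
    rw [← hv.coverFlow_add, add_neg_cancel, hv.isGlobalFlow.zero]
  have hinv' : ∀ s x, coverFlow v (-s) (coverFlow v s x) = x := fun s x => by
    rw [← hv.coverFlow_add, neg_add_cancel, hv.isGlobalFlow.zero]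
  set G := coverFlow v (-t)
  have hGc : Continuous G := hv.continuous_coverFlow.comp (Continuous.prodMk_right (-t))
  -- `G` commutes with lattice translations, so `G ⁻¹' cube` is another fundamental domain. The left
  -- side is integrated over `cube`, the right side over `G ⁻¹' cube`, and `G` maps the second onto
  -- the first.
  have hS : MeasurableSet (G ⁻¹' cube) := hGc.measurable measurableSet_cube
  have himage : G '' (G ⁻¹' cube) = cube :=
    image_preimage_eq _ fun y => ⟨coverFlow v t y, hinv' t y⟩
  have hm1 : Measurable (fun x => g (flow v t x)) :=
    hg.comp (hv.measurable_flow.comp measurable_prodMk_left)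
  have hm2 : Measurable (fun y => ENNReal.ofReal (dInvFlow v t y).det * g y) :=
    (hv.measurable_det_dInvFlow.comp measurable_prodMk_left).ennreal_ofReal.mul hg
  rw [← setLIntegral_proj measurableSet_cube existsUnique_add_mem_cube hm1,
    ← setLIntegral_proj hS (fun x => by
      simp only [mem_preimage, G, hv.coverFlow_add_latticePoint]
      exact existsUnique_add_mem_cube _) hm2]
  nth_rewrite 1 [← himage]
  rw [lintegral_image_eq_lintegral_abs_det_fderiv_mul volume hS
    (fun x _ => (hv.differentiableAt_coverFlow (-t) x).hasFDerivAt.hasFDerivWithinAt)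
    (fun x _ y _ hxy => by rw [← hinv t x, ← hinv t y]; exact congrArg _ hxy)]
  refine lintegral_congr fun x => ?_
  rw [hv.flow_proj, hinv, hv.dInvFlow_proj, abs_of_pos (hv.det_fderiv_coverFlow_pos _ _)]

/-- The inverse flow does not charge null sets. -/
lemma SmoothField.ae_invFlow (hv : SmoothField v) (t : ℝ) {p : Torus → Prop}
    (hp : ∀ᵐ x, p x) : ∀ᵐ x, p (invFlow v t x) := by
  have hN : volume (toMeasurable volume {x | ¬ p x}) = 0 := by
    rw [measure_toMeasurable]; exact hp
  set N := toMeasurable volume {x | ¬ p x}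
  have hNm : MeasurableSet N := measurableSet_toMeasurable _ _
  have h := hv.lintegral_flow (-t) (g := N.indicator 1) (measurable_one.indicator hNm)
  have hz : ∀ᵐ y, ENNReal.ofReal (dInvFlow v (-t) y).det * N.indicator 1 y = 0 := by
    filter_upwards [measure_eq_zero_iff_ae_notMem.1 hN] with y hy
    simp [hy]
  have hm : Measurable fun x => N.indicator (1 : Torus → ℝ≥0∞) (flow v (-t) x) :=
    (measurable_one.indicator hNm).comp (hv.measurable_flow.comp measurable_prodMk_left)
  rw [lintegral_congr_ae hz, lintegral_zero, lintegral_eq_zero_iff hm] at h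
  filter_upwards [h] with x hx
  by_contra hpx
  have : flow v (-t) x ∈ N := subset_toMeasurable _ _ hpx
  simp [this] at hx

/-- A map whose derivative is everywhere invertible pulls null sets back to null sets. -/
lemma measure_preimage_eq_zero_of_det_ne_zero {E : Type*} [NormedAddCommGroup E]
    [NormedSpace ℝ E] [FiniteDimensional ℝ E] [Nontrivial E] [MeasurableSpace E] [BorelSpace E]
    (μ : Measure E) [μ.IsAddHaarMeasure] {f : E → E} {f' : E → E →L[ℝ] E}
    (hf : ∀ x, HasFDerivAt f (f' x) x) (hdet : ∀ x, (f' x).det ≠ 0) {N : Set E} (hN : μ N = 0) :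
    μ (f ⁻¹' N) = 0 := by
  classical
  -- Half the threshold below which a map approximated by the invertible `A` is injective. The value
  -- for singular `A` only has to be nonzero.
  let r : (E →L[ℝ] E) → ℝ≥0 := fun A =>
    if h : A.det ≠ 0 then ‖((A.toContinuousLinearEquivOfDetNeZero h).symm : E →L[ℝ] E)‖₊⁻¹ / 2
    else 1
  have hpos : ∀ B : E ≃L[ℝ] E, 0 < ‖(B.symm : E →L[ℝ] E)‖₊⁻¹ := fun B =>
    inv_pos.2 B.nnnorm_symm_pos
  have hr : ∀ A, r A ≠ 0 := fun A => by
    simp only [r]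
    split_ifs with h
    · exact (half_pos (hpos _)).ne'
    · exact one_ne_zero
  -- Countably many pieces on each of which `f` is injective. There the area formula equates the
  -- integral of `|det f'|` over the part landing in the null set with the measure of its image,
  -- which is zero.
  obtain ⟨t, A, ht, hcov, happ, hA⟩ :=
    exists_closed_cover_approximatesLinearOn_of_hasFDerivWithinAt f univ f'
      (fun x _ => (hf x).hasFDerivWithinAt) r hr
  set N' := toMeasurable μ N
  have hN' : μ N' = 0 := by rwa [measure_toMeasurable]
  have hfc : Continuous f := continuous_iff_continuousAt.2 fun x => (hf x).continuousAt
  have key : ∀ n, μ (t n ∩ f ⁻¹' N') = 0 := by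
    intro n
    obtain ⟨y, -, hy⟩ := hA univ_nonempty n
    have hdn : (A n).det ≠ 0 := by rw [hy]; exact hdet y
    have hinj : InjOn f (t n) := by
      have h1 := happ n
      rw [univ_inter] at h1
      have h2 : r (A n) = ‖(((A n).toContinuousLinearEquivOfDetNeZero hdn).symm :
          E →L[ℝ] E)‖₊⁻¹ / 2 := dif_pos hdn
      refine ApproximatesLinearOn.injOn (f' := (A n).toContinuousLinearEquivOfDetNeZero hdn)
        (c := r (A n)) ?_ (Or.inr ?_)
      · simpa using h1
      · rw [h2]; exact half_lt_self (hpos _)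
    have hs : MeasurableSet (t n ∩ f ⁻¹' N') :=
      (ht n).measurableSet.inter (hfc.measurable (measurableSet_toMeasurable _ _))
    have hd : ∀ x ∈ t n ∩ f ⁻¹' N', HasFDerivWithinAt f (f' x) (t n ∩ f ⁻¹' N') x :=
      fun x _ => (hf x).hasFDerivWithinAt
    have h3 := lintegral_abs_det_fderiv_eq_addHaar_image μ hs hd (hinj.mono inter_subset_left)
    have h4 : μ (f '' (t n ∩ f ⁻¹' N')) = 0 :=
      measure_mono_null (by rintro _ ⟨x, hx, rfl⟩; exact hx.2) hN'
    rw [h4, lintegral_eq_zero_iff' (aemeasurable_ofReal_abs_det_fderivWithin μ hs hd)] at h3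
    rw [← Measure.restrict_eq_zero, ← ae_eq_bot, ← Filter.eventually_false_iff_eq_bot]
    filter_upwards [h3] with x hx
    have hx' : |(f' x).det| ≤ 0 := ENNReal.ofReal_eq_zero.1 hx
    exact hdet x (abs_nonpos_iff.1 hx')
  refine measure_mono_null (fun x hx => ?_) (measure_iUnion_null key)
  obtain ⟨n, hn⟩ := mem_iUnion.1 (hcov (mem_univ x))
  exact mem_iUnion.2 ⟨n, hn, subset_toMeasurable _ _ hx⟩

/-- The linear map `k ↦ k₀ a + k₁ b`. -/
def pairMap (a b : Plane) : Plane →L[ℝ] Plane :=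
  (ContinuousLinearMap.proj (R := ℝ) (φ := fun _ : Fin 2 => ℝ) 0).smulRight a +
    (ContinuousLinearMap.proj (R := ℝ) (φ := fun _ : Fin 2 => ℝ) 1).smulRight b

lemma det_pairMap_ne_zero {a b : Plane} (h : Submodule.span ℝ {a, b} = ⊤) :
    (pairMap a b).det ≠ 0 := by
  have hsurj : Function.Surjective (pairMap a b).toLinearMap := fun y => by
    have hy : y ∈ Submodule.span ℝ {a, b} := h ▸ Submodule.mem_top
    obtain ⟨c, d, rfl⟩ := Submodule.mem_span_pair.1 hy
    exact ⟨![c, d], by simp [pairMap]⟩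
  have hinj := LinearMap.injective_iff_surjective.2 hsurj
  exact (LinearEquiv.ofBijective _ ⟨hinj, hsurj⟩).isUnit_det'.ne_zero

/-- Following two transversal fields for independent times does not charge null sets. -/
lemma ae_flow_flow_notMem (hv : SmoothField v) (hw : SmoothField w)
    (h : ∀ x, Submodule.span ℝ {v x, w x} = ⊤) {N : Set Torus} (hN : volume N = 0) (x : Torus) :
    ∀ᵐ p : ℝ × ℝ, flow v p.1 (flow w p.2 x) ∉ N := by
  obtain ⟨K, M, C, hV⟩ := hv.exists_tameField
  set y : ℝ → Plane := fun s => coverFlow w s (rep x)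
  -- Since `v` is invariant under its own flow, the derivative in the outer time is also the image
  -- under the differential of that flow of `v` at `y (p 1)`. Factoring the differential out leaves
  -- `v` and `w` at one common point, where they span.
  have hd : ∀ p : Plane, HasFDerivAt (fun p : Plane => coverFlow v (p 0) (y (p 1)))
      ((fderiv ℝ (coverFlow v (p 0)) (y (p 1))).comp
        (pairMap (v (proj (y (p 1)))) (w (proj (y (p 1)))))) p := by
    intro p
    have h1 := hV.hasFDerivAt_flow_uncurry hv.isGlobalFlow (p 0) (y (p 1))
    have h2 : HasFDerivAt (fun p : Plane => y (p 1))
        ((ContinuousLinearMap.proj (R := ℝ) (φ := fun _ : Fin 2 => ℝ) 1).smulRight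
          (w (proj (y (p 1))))) p := by
      have h3 := (hw.isGlobalFlow.hasDerivAt (rep x) (p 1)).hasFDerivAt.comp p
        (ContinuousLinearMap.proj (R := ℝ) (φ := fun _ : Fin 2 => ℝ) 1).hasFDerivAt
      refine h3.congr_fderiv ?_
      ext k : 1
      simp [y]
    have h4 : HasFDerivAt (fun p : Plane => p 0)
        (ContinuousLinearMap.proj (R := ℝ) (φ := fun _ : Fin 2 => ℝ) 0) p :=
      (ContinuousLinearMap.proj (R := ℝ) (φ := fun _ : Fin 2 => ℝ) 0).hasFDerivAt
    have h5 := HasFDerivAt.comp p (g := fun p : ℝ × Plane => coverFlow v p.1 p.2) h1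
      (h4.prodMk h2)
    refine h5.congr_fderiv ?_
    ext k : 1
    have h6 := hV.fderiv_flow_apply hv.isGlobalFlow (p 0) (y (p 1))
    simp only [pairMap, ContinuousLinearMap.comp_apply, add_apply,
      ContinuousLinearMap.smulRight_apply, ContinuousLinearMap.prod_apply, map_add, map_smul,
      ContinuousLinearMap.coe_fst', ContinuousLinearMap.coe_snd', h6]
  have hnull := measure_preimage_eq_zero_of_det_ne_zero volume hd (fun p => by
    rw [det_clm_comp]
    exact mul_ne_zero (hv.det_fderiv_coverFlow_pos _ _).ne' (det_pairMap_ne_zero (h _)))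
    (volume_proj_preimage_eq_zero hN)
  have hmp := (volume_preserving_finTwoArrow ℝ).symm
  have hnull' := hmp.quasiMeasurePreserving.preimage_null hnull
  rw [measure_eq_zero_iff_ae_notMem] at hnull'
  filter_upwards [hnull'] with p hp hmem
  refine hp ?_
  simp only [mem_preimage, y]
  rw [← hv.flow_proj, ← hw.flow_proj, proj_rep]
  simpa using hmem

end Lebesgue

/-! ### The waiting times -/

section Waiting

open scoped NNReal ENNReal Topology

variable {lam : ℝ}

lemma lintegral_expMeasure {f : ℝ → ℝ≥0∞} (hf : Measurable f) :
    ∫⁻ r, f r ∂expMeasure lam =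
      ∫⁻ r in Ioi 0, ENNReal.ofReal (lam * Real.exp (-lam * r)) * f r := by
  have h1 : ∫⁻ r, f r ∂expMeasure lam = ∫⁻ r, exponentialPDF lam r * f r :=
    lintegral_withDensity_eq_lintegral_mul _ (measurable_exponentialPDFReal lam).ennreal_ofReal hf
  rw [h1, restrict_Ioi_eq_restrict_Ici, ← lintegral_indicator measurableSet_Ici]
  refine lintegral_congr fun r => ?_
  by_cases hr : 0 ≤ r
  · rw [indicator_of_mem (show r ∈ Ici 0 from hr), exponentialPDF_of_nonneg hr, neg_mul]
  · rw [indicator_of_notMem (show r ∉ Ici 0 from hr), exponentialPDF_of_neg (not_le.1 hr), zero_mul]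

lemma expMeasure_Iic (hlam : 0 < lam) {a : ℝ} (ha : 0 ≤ a) :
    expMeasure lam (Iic a) = ENNReal.ofReal (1 - Real.exp (-lam * a)) := by
  have := isProbabilityMeasure_expMeasure hlam
  rw [← ofReal_cdf, cdf_expMeasure_eq hlam, if_pos ha, neg_mul]

lemma expMeasure_Ioi (hlam : 0 < lam) {a : ℝ} (ha : 0 ≤ a) :
    expMeasure lam (Ioi a) = ENNReal.ofReal (Real.exp (-lam * a)) := by
  have := isProbabilityMeasure_expMeasure hlam
  have h1 : Real.exp (-lam * a) ≤ 1 := Real.exp_le_one_iff.2 (by nlinarith)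
  rw [← compl_Iic, prob_compl_eq_one_sub measurableSet_Iic, expMeasure_Iic hlam ha,
    ← ENNReal.ofReal_one, ← ENNReal.ofReal_sub _ (by linarith)]
  congr 1; ring

lemma isProbabilityMeasure_waitingLaw (hlam : 0 < lam) :
    IsProbabilityMeasure (waitingLaw lam) := by
  have := isProbabilityMeasure_expMeasure hlam
  unfold waitingLaw
  infer_instance

lemma ae_waiting_pos (hlam : 0 < lam) : ∀ᵐ τ ∂waitingLaw lam, ∀ k, 0 < τ k := by
  have := isProbabilityMeasure_expMeasure hlam
  rw [ae_all_iff]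
  intro k
  have h := (measurePreserving_eval_infinitePi (fun _ : ℕ => expMeasure lam) k)
  have h0 : ∀ᵐ r ∂expMeasure lam, 0 < r := by
    rw [ae_iff]
    have : {a : ℝ | ¬ 0 < a} = Iic 0 := by ext; simp
    rw [this, expMeasure_Iic hlam le_rfl]
    simp
  exact h.quasiMeasurePreserving.ae h0

/-- Excludes accumulation of switches: the first `n` waiting times are all at most `m` with
probability `c ^ n`, where `c < 1`. -/
lemma ae_exists_lt_waiting (hlam : 0 < lam) :
    ∀ᵐ τ ∂waitingLaw lam, ∀ m : ℕ, ∃ k, (m : ℝ) < τ k := by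
  have := isProbabilityMeasure_expMeasure hlam
  rw [ae_all_iff]
  intro m
  have hm : (0 : ℝ) ≤ m := m.cast_nonneg
  rw [ae_iff]
  set c : ℝ≥0∞ := ENNReal.ofReal (1 - Real.exp (-lam * m))
  have hc : c < 1 := by
    rw [ENNReal.ofReal_lt_one]
    linarith [Real.exp_pos (-lam * m)]
  have hle : ∀ n : ℕ, waitingLaw lam {τ | ¬ ∃ k, (m : ℝ) < τ k} ≤ c ^ n := by
    intro n
    have h1 : waitingLaw lam (Set.pi (Finset.range n) fun _ => Iic (m : ℝ)) = c ^ n := by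
      rw [waitingLaw, Measure.infinitePi_pi _ (fun _ _ => measurableSet_Iic)]
      simp [expMeasure_Iic hlam hm, c]
    rw [← h1]
    refine measure_mono fun τ hτ k _ => ?_
    simp only [not_exists, not_lt, mem_ofPred_eq] at hτ
    exact hτ k
  refine le_antisymm (ge_of_tendsto' (ENNReal.tendsto_pow_atTop_nhds_zero_of_lt_one hc) hle)
    zero_le

/-! ### Switch times and the number of switches -/

lemma strictMono_switchTime {τ : ℕ → ℝ} (hτ : ∀ k, 0 < τ k) : StrictMono (switchTime τ) :=
  strictMono_nat_of_lt_succ fun n => by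
    rw [switchTime, switchTime, Finset.sum_range_succ]
    linarith [hτ n]

lemma switchTime_zero (τ : ℕ → ℝ) : switchTime τ 0 = 0 := by simp [switchTime]

lemma switchTime_succ (τ : ℕ → ℝ) (n : ℕ) : switchTime τ (n + 1) = switchTime τ n + τ n := by
  rw [switchTime, switchTime, Finset.sum_range_succ]

lemma switchCount_eq {τ : ℕ → ℝ} (hτ : ∀ k, 0 < τ k) {t : ℝ} {n : ℕ}
    (h1 : switchTime τ n ≤ t) (h2 : t < switchTime τ n + τ n) : switchCount τ t = n := by
  rw [← switchTime_succ] at h2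
  have hm := strictMono_switchTime hτ
  have : {m : ℕ | switchTime τ (m + 1) ≤ t} = Iio n := by
    ext m
    simp only [mem_ofPred_eq, mem_Iio]
    constructor
    · intro h
      have := hm.lt_iff_lt.1 (h.trans_lt h2)
      omega
    · intro h
      exact (hm.monotone (by omega : m + 1 ≤ n)).trans h1
  rw [switchCount, this, Set.ncard_eq_toFinset_card' (Iio n)]
  simp

lemma exists_switchTime_le_lt {τ : ℕ → ℝ} (hτ : ∀ k, 0 < τ k) (hub : ∀ m : ℕ, ∃ k, (m : ℝ) < τ k)
    {t : ℝ} (ht : 0 ≤ t) : ∃ n, switchTime τ n ≤ t ∧ t < switchTime τ n + τ n := by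
  classical
  have hex : ∃ n, t < switchTime τ n := by
    obtain ⟨m, hm⟩ := exists_nat_gt t
    obtain ⟨k, hk⟩ := hub m
    refine ⟨k + 1, hm.trans (hk.trans_le ?_)⟩
    rw [switchTime_succ]
    have := (strictMono_switchTime hτ).monotone (Nat.zero_le k)
    rw [switchTime_zero] at this
    linarith
  have hne : Nat.find hex ≠ 0 := fun h0 => by
    have := Nat.find_spec hex
    rw [h0, switchTime_zero] at this
    linarith
  obtain ⟨n, hn⟩ := Nat.exists_eq_succ_of_ne_zero hne
  refine ⟨n, not_lt.1 (Nat.find_min hex (by omega)), ?_⟩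
  rw [← switchTime_succ]
  have := Nat.find_spec hex
  rwa [hn] at this

end Waiting

/-! ### The law of the process -/

section ProcessLaw

open scoped NNReal ENNReal Topology

variable {u : Fin 2 → Torus → Plane} {lam : ℝ}

lemma measurable_flow_index (hu : ∀ i, SmoothField (u i)) :
    Measurable (fun p : ℝ × Torus × Fin 2 => flow (u p.2.2) p.1 p.2.1) := by
  have h : ∀ i, Measurable (fun p : ℝ × Torus × Fin 2 => flow (u i) p.1 p.2.1) := fun i =>
    (hu i).measurable_flow.comp (measurable_fst.prodMk (measurable_fst.comp measurable_snd))
  have he : (fun p : ℝ × Torus × Fin 2 => flow (u p.2.2) p.1 p.2.1) =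
      fun p => if p.2.2 = 0 then flow (u 0) p.1 p.2.1 else flow (u 1) p.1 p.2.1 := by
    funext ⟨t, x, j⟩
    fin_cases j <;> simp
  rw [he]
  refine Measurable.ite ?_ (h 0) (h 1)
  exact (measurable_snd.comp measurable_snd) (measurableSet_singleton 0)

/-- The time and the state right after the `n`-th switch. -/
def chain (u : Fin 2 → Torus → Plane) (z : Torus × Fin 2) (τ : ℕ → ℝ) (n : ℕ) :
    ℝ × Torus × Fin 2 :=
  (switchTime τ n, postSwitch u z τ n)

/-- One step of the chain of switches. -/
def chainStep (u : Fin 2 → Torus → Plane) (c : ℝ × Torus × Fin 2) (r : ℝ) : ℝ × Torus × Fin 2 :=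
  (c.1 + r, flow (u c.2.2) r c.2.1, 1 - c.2.2)

lemma chain_zero (z : Torus × Fin 2) (τ : ℕ → ℝ) : chain u z τ 0 = (0, z) := by
  rw [chain, switchTime_zero]; rfl

lemma chain_succ (z : Torus × Fin 2) (τ : ℕ → ℝ) (n : ℕ) :
    chain u z τ (n + 1) = chainStep u (chain u z τ n) (τ n) := by
  rw [chain, switchTime_succ]; rfl

lemma chain_congr (z : Torus × Fin 2) {τ τ' : ℕ → ℝ} {n : ℕ} (h : ∀ k < n, τ k = τ' k) :
    chain u z τ n = chain u z τ' n := by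
  induction n with
  | zero => rw [chain_zero, chain_zero]
  | succ n ih =>
    rw [chain_succ, chain_succ, ih fun k hk => h k (by omega), h n (by omega)]

lemma measurable_chainStep (hu : ∀ i, SmoothField (u i)) :
    Measurable (fun p : (ℝ × Torus × Fin 2) × ℝ => chainStep u p.1 p.2) := by
  refine ((measurable_fst.comp measurable_fst).add measurable_snd).prodMk (Measurable.prodMk ?_ ?_)
  · exact (measurable_flow_index hu).comp
      (measurable_snd.prodMk (measurable_snd.comp measurable_fst))
  · exact (measurable_of_finite (fun j : Fin 2 => 1 - j)).comp
      (measurable_snd.comp (measurable_snd.comp measurable_fst))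

lemma measurable_chain (hu : ∀ i, SmoothField (u i)) (n : ℕ) :
    Measurable (fun p : (Torus × Fin 2) × (ℕ → ℝ) => chain u p.1 p.2 n) := by
  induction n with
  | zero => simp only [chain_zero]; exact measurable_const.prodMk measurable_fst
  | succ n ih =>
    simp only [chain_succ]
    exact (measurable_chainStep hu).comp
      (ih.prodMk ((measurable_pi_apply n).comp measurable_snd))

/-- The next waiting time is independent of the chain so far. -/
lemma lintegral_chain_waiting (hu : ∀ i, SmoothField (u i)) (hlam : 0 < lam) (z : Torus × Fin 2)
    (n : ℕ) {H : (ℝ × Torus × Fin 2) × ℝ → ℝ≥0∞} (hH : Measurable H) :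
    ∫⁻ τ, H (chain u z τ n, τ n) ∂waitingLaw lam =
      ∫⁻ τ, ∫⁻ r, H (chain u z τ n, r) ∂expMeasure lam ∂waitingLaw lam := by
  have := isProbabilityMeasure_expMeasure hlam
  have := isProbabilityMeasure_waitingLaw hlam
  have hc : Measurable (fun τ : ℕ → ℝ => chain u z τ n) :=
    (measurable_chain hu n).comp measurable_prodMk_left
  have hev : Measurable (fun τ : ℕ → ℝ => τ n) := measurable_pi_apply n
  have hindep : IndepFun (fun τ : ℕ → ℝ => chain u z τ n) (fun τ => τ n) (waitingLaw lam) := by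
    have h1 : iIndepFun (fun (k : ℕ) (τ : ℕ → ℝ) => τ k) (waitingLaw lam) :=
      iIndepFun_infinitePi (P := fun _ : ℕ => expMeasure lam) (X := fun _ r => r)
        (fun _ => measurable_id)
    have h2 := h1.indepFun_finset (Finset.range n) {n} (by simp) (fun k => measurable_pi_apply k)
    -- Padding with zeros exhibits the chain after `n` switches as a function of the first `n`
    -- waiting times only, hence independent of `τ n`.
    let ext : ((Finset.range n) → ℝ) → ℕ → ℝ := fun w k =>
      if h : k ∈ Finset.range n then w ⟨k, h⟩ else 0
    have hext : Measurable ext := measurable_pi_lambda _ fun k => by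
      by_cases h : k ∈ Finset.range n
      · simp only [ext, dif_pos h]; exact measurable_pi_apply _
      · simp only [ext, dif_neg h]; exact measurable_const
    have h3 := h2.comp (hc.comp hext) (measurable_pi_apply (⟨n, by simp⟩ : ({n} : Finset ℕ)))
    convert h3 using 1
    · funext τ
      refine chain_congr z fun k hk => ?_
      simp [ext, hk]
    · rfl
  have hmap := hindep.map_prod_eq_prod_map_map hc.aemeasurable hev.aemeasurable
  have hlaw : (waitingLaw lam).map (fun τ : ℕ → ℝ => τ n) = expMeasure lam :=
    Measure.infinitePi_map_eval (fun _ : ℕ => expMeasure lam) n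
  rw [hlaw] at hmap
  rw [← lintegral_map hH (hc.prodMk hev), hmap, lintegral_prod _ hH.aemeasurable,
    lintegral_map hH.lintegral_prod_right' hc]

/-- The contribution at time `t`, in the mean over the next waiting time, of a chain that has last
switched in state `c`. -/
def contrib (u : Fin 2 → Torus → Plane) (lam t : ℝ) (g : Torus × Fin 2 → ℝ≥0∞)
    (c : ℝ × Torus × Fin 2) : ℝ≥0∞ :=
  (Iic t).indicator 1 c.1 * (ENNReal.ofReal (Real.exp (-lam * (t - c.1))) *
    g (flow (u c.2.2) (t - c.1) c.2.1, c.2.2))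

lemma measurable_contrib (hu : ∀ i, SmoothField (u i)) {G : ℝ × Torus × Fin 2 → ℝ≥0∞}
    (hG : Measurable G) : Measurable (fun p : ℝ × ℝ × Torus × Fin 2 =>
      contrib u lam p.1 (fun z => G (p.1, z)) p.2) := by
  unfold contrib
  have h1 : Measurable (fun p : ℝ × ℝ × Torus × Fin 2 => (Iic p.1).indicator (1 : ℝ → ℝ≥0∞) p.2.1) := by
    have : (fun p : ℝ × ℝ × Torus × Fin 2 => (Iic p.1).indicator (1 : ℝ → ℝ≥0∞) p.2.1) =
        {p : ℝ × ℝ × Torus × Fin 2 | p.2.1 ≤ p.1}.indicator 1 := rfl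
    rw [this]
    exact measurable_one.indicator
      (measurableSet_le (measurable_fst.comp measurable_snd) measurable_fst)
  have h2 : Measurable (fun p : ℝ × ℝ × Torus × Fin 2 => p.1 - p.2.1) := by fun_prop
  have h3 : Measurable (fun p : ℝ × ℝ × Torus × Fin 2 => flow (u p.2.2.2) (p.1 - p.2.1) p.2.2.1) :=
    (measurable_flow_index hu).comp (h2.prodMk (measurable_snd.comp measurable_snd))
  refine h1.mul (Measurable.mul (by fun_prop) (hG.comp ?_))
  exact measurable_fst.prodMk (h3.prodMk
    (measurable_snd.comp (measurable_snd.comp measurable_snd)))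

/-- The probability to be in `B` at time `t` after exactly `n` switches, see `transProb_eq_tsum`. -/
def nSwitch (u : Fin 2 → Torus → Plane) (lam t : ℝ) (n : ℕ) (z : Torus × Fin 2)
    (g : Torus × Fin 2 → ℝ≥0∞) : ℝ≥0∞ :=
  ∫⁻ τ, contrib u lam t g (chain u z τ n) ∂waitingLaw lam

lemma measurable_nSwitch (hu : ∀ i, SmoothField (u i)) (hlam : 0 < lam)
    {G : ℝ × Torus × Fin 2 → ℝ≥0∞} (hG : Measurable G) (n : ℕ) :
    Measurable (fun p : ℝ × Torus × Fin 2 =>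
      nSwitch u lam p.1 n p.2 (fun z => G (p.1, z))) := by
  have := isProbabilityMeasure_waitingLaw hlam
  unfold nSwitch
  refine Measurable.lintegral_prod_right' (f := fun q : (ℝ × Torus × Fin 2) × (ℕ → ℝ) =>
    contrib u lam q.1.1 (fun z => G (q.1.1, z)) (chain u q.1.2 q.2 n)) ?_
  exact (measurable_contrib hu hG).comp ((measurable_fst.comp measurable_fst).prodMk
    ((measurable_chain hu n).comp
      ((measurable_snd.comp measurable_fst).prodMk measurable_snd)))

/-- The transition probability as a sum over the number of switches. -/
lemma transProb_eq_tsum (hu : ∀ i, SmoothField (u i)) (hlam : 0 < lam) {t : ℝ} (ht : 0 ≤ t)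
    (z : Torus × Fin 2) {B : Set (Torus × Fin 2)} (hB : MeasurableSet B) :
    transProb u lam t z B = ∑' n, nSwitch u lam t n z (B.indicator 1) := by
  have := isProbabilityMeasure_expMeasure hlam
  have := isProbabilityMeasure_waitingLaw hlam
  -- The last switch is at or before `t`, the next one is after `t`, and the state at `t` lies in
  -- `B`. Averaging over the next waiting time produces the survival factor in `contrib`.
  let D : Set ((ℝ × Torus × Fin 2) × ℝ) := {p | p.1.1 ≤ t ∧ t < p.1.1 + p.2 ∧
    (flow (u p.1.2.2) (t - p.1.1) p.1.2.1, p.1.2.2) ∈ B}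
  have hD : MeasurableSet D := by
    have h1 : Measurable (fun p : (ℝ × Torus × Fin 2) × ℝ => p.1.1) := by fun_prop
    refine (measurableSet_le h1 measurable_const).inter
      ((measurableSet_lt measurable_const (h1.add measurable_snd)).inter ?_)
    have h2 : Measurable (fun p : (ℝ × Torus × Fin 2) × ℝ => t - p.1.1) := by fun_prop
    exact (((measurable_flow_index hu).comp (h2.prodMk (measurable_snd.comp measurable_fst))).prodMk
      (measurable_snd.comp (measurable_snd.comp measurable_fst))) hB
  let A : ℕ → Set (ℕ → ℝ) := fun n => {τ | (chain u z τ n, τ n) ∈ D}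
  have hpair : ∀ n, Measurable (fun τ : ℕ → ℝ => (chain u z τ n, τ n)) := fun n =>
    ((measurable_chain hu n).comp measurable_prodMk_left).prodMk (measurable_pi_apply n)
  have hA : ∀ n, MeasurableSet (A n) := fun n => hpair n hD
  have hAn : ∀ n, waitingLaw lam (A n) = nSwitch u lam t n z (B.indicator 1) := by
    intro n
    have h1 : waitingLaw lam (A n) =
        ∫⁻ τ, D.indicator 1 (chain u z τ n, τ n) ∂waitingLaw lam := by
      rw [← lintegral_indicator_one (hA n)]; rfl
    rw [h1, lintegral_chain_waiting hu hlam z n (measurable_one.indicator hD), nSwitch]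
    refine lintegral_congr fun τ => ?_
    rw [contrib]
    set c := chain u z τ n
    by_cases hc : c.1 ≤ t
    · rw [indicator_of_mem (show c.1 ∈ Iic t from hc), Pi.one_apply, one_mul,
        ← expMeasure_Ioi hlam (sub_nonneg.2 hc), ← lintegral_indicator_one measurableSet_Ioi,
        ← lintegral_mul_const _ (measurable_one.indicator measurableSet_Ioi)]
      refine lintegral_congr fun r => ?_
      simp only [indicator, D, mem_ofPred_eq, hc, true_and, mem_Ioi, sub_lt_iff_lt_add',
        Pi.one_apply]
      split_ifs <;> simp_all
    · rw [indicator_of_notMem (show c.1 ∉ Iic t from hc), zero_mul]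
      simp [indicator, D, hc]
  have hset : {τ | state u z t τ ∈ B} =ᵐ[waitingLaw lam] ⋃ n, A n := by
    filter_upwards [ae_waiting_pos hlam, ae_exists_lt_waiting hlam] with τ h1 h2
    refine propext (Iff.trans ?_ mem_iUnion.symm)
    change state u z t τ ∈ B ↔ _
    constructor
    · intro h
      obtain ⟨n, hn1, hn2⟩ := exists_switchTime_le_lt h1 h2 ht
      refine ⟨n, hn1, hn2, ?_⟩
      rwa [state, switchCount_eq h1 hn1 hn2] at h
    · rintro ⟨n, hn1, hn2, hn3⟩
      rw [state, switchCount_eq h1 hn1 hn2]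
      exact hn3
  rw [transProb, measure_congr hset, measure_iUnion₀ ?_ fun n => (hA n).nullMeasurableSet]
  · simp only [hAn]
  · intro m n hmn
    refine measure_mono_null ?_ (ae_waiting_pos hlam)
    rintro τ ⟨⟨h1, h2, -⟩, h3, h4, -⟩ hτ
    exact hmn ((switchCount_eq hτ h1 h2).symm.trans (switchCount_eq hτ h3 h4))

end ProcessLaw

/-! ### Conditioning on the last switch -/

section LastSwitch

open scoped NNReal ENNReal Topology

variable {u : Fin 2 → Torus → Plane} {lam : ℝ}

/-- The density of the waiting time. -/
def expWeight (lam r : ℝ) : ℝ≥0∞ := ENNReal.ofReal (lam * Real.exp (-lam * r))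

lemma measurable_expWeight : Measurable (expWeight lam) := by
  unfold expWeight
  fun_prop

/-- The states with index `1 - i` from which the flow `i` leads into `E` after time `r`. -/
def preSwitch (u : Fin 2 → Torus → Plane) (i : Fin 2) (E : Set Torus) (r : ℝ) :
    Set (Torus × Fin 2) :=
  (flow (u i) r ⁻¹' E) ×ˢ {1 - i}

lemma measurableSet_flow_preimage (hu : ∀ i, SmoothField (u i)) (i : Fin 2) {E : Set Torus}
    (hE : MeasurableSet E) (r : ℝ) : MeasurableSet (flow (u i) r ⁻¹' E) :=
  ((hu i).measurable_flow.comp measurable_prodMk_left) hE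

lemma measurable_preSwitch (hu : ∀ i, SmoothField (u i)) (i : Fin 2) {E : Set Torus}
    (hE : MeasurableSet E) (t : ℝ) : Measurable (fun p : ℝ × Torus × Fin 2 =>
      (preSwitch u i E (t - p.1)).indicator (1 : Torus × Fin 2 → ℝ≥0∞) p.2) := by
  have h : MeasurableSet {p : ℝ × Torus × Fin 2 | p.2 ∈ preSwitch u i E (t - p.1)} := by
    have h1 : Measurable (fun p : ℝ × Torus × Fin 2 => flow (u i) (t - p.1) p.2.1) :=
      (hu i).measurable_flow.comp
        ((measurable_const.sub measurable_fst).prodMk (measurable_fst.comp measurable_snd))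
    have h2 : Measurable (fun p : ℝ × Torus × Fin 2 => p.2.2) :=
      measurable_snd.comp measurable_snd
    exact (h1 hE).inter (h2 (measurableSet_singleton (1 - i)))
  exact measurable_one.indicator h

lemma one_sub_eq_iff {i j : Fin 2} : 1 - j = i ↔ j = 1 - i := by
  revert i j; decide

/-- Substitute `s = c.1 + r`, the time of the last switch. The weights match because both products
equal $\lambda e^{-\lambda(t-S)}$ with `S = c.1`, and `hc` ensures that `s` is positive on the range
of integration. -/
lemma lintegral_contrib_chainStep (hlam : 0 < lam) (t : ℝ) (i : Fin 2) (E : Set Torus)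
    {c : ℝ × Torus × Fin 2} (hc : 0 ≤ c.1) :
    ∫⁻ r in Ioi 0, expWeight lam r * contrib u lam t ((E ×ˢ {i}).indicator 1) (chainStep u c r) =
      ∫⁻ s in Ioc 0 t, expWeight lam (t - s) *
        contrib u lam s ((preSwitch u i E (t - s)).indicator 1) c := by
  obtain ⟨S, y, j⟩ := c
  simp only at hc
  rw [← lintegral_indicator measurableSet_Ioi, ← lintegral_indicator measurableSet_Ioc,
    ← lintegral_sub_right_eq_self _ S]
  -- At `s = S` the two integrands may differ: the left domain excludes it, the indicator on the
  -- right includes it.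
  have hne : ∀ᵐ s : ℝ, s ≠ S := by simp [ae_iff]
  refine lintegral_congr_ae ?_
  filter_upwards [hne] with s hs
  by_cases h : S < s ∧ s ≤ t
  · rw [indicator_of_mem (show s - S ∈ Ioi 0 from sub_pos.2 h.1),
      indicator_of_mem (show s ∈ Ioc 0 t from ⟨hc.trans_lt h.1, h.2⟩)]
    simp only [contrib, chainStep, add_sub_cancel]
    rw [indicator_of_mem (show s ∈ Iic t from h.2), indicator_of_mem (show S ∈ Iic s from h.1.le),
      Pi.one_apply, Pi.one_apply, one_mul, one_mul, ← mul_assoc, ← mul_assoc, expWeight, expWeight,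
      ← ENNReal.ofReal_mul (by positivity), ← ENNReal.ofReal_mul (by positivity)]
    congr 1
    · congr 1; ring
    · have hiff : (flow (u (1 - j)) (t - s) (flow (u j) (s - S) y), 1 - j) ∈ E ×ˢ {i} ↔
          (flow (u j) (s - S) y, j) ∈ preSwitch u i E (t - s) := by
        rw [preSwitch, mem_prod, mem_prod, mem_singleton_iff, mem_singleton_iff, mem_preimage,
          ← one_sub_eq_iff]
        exact and_congr_left fun h => by rw [← h]
      by_cases hm : (flow (u j) (s - S) y, j) ∈ preSwitch u i E (t - s)
      · rw [indicator_of_mem hm, indicator_of_mem (hiff.2 hm)]; rfl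
      · rw [indicator_of_notMem hm, indicator_of_notMem fun h => hm (hiff.1 h)]
  · by_cases hst : s ≤ t
    · have hs' : ¬ S ≤ s := fun h1 => h ⟨lt_of_le_of_ne h1 (Ne.symm hs), hst⟩
      have h2 : s - S ∉ Ioi 0 := fun h2 => hs' (sub_pos.1 h2).le
      rw [indicator_of_notMem h2]
      symm
      rw [indicator_apply_eq_zero]
      intro _
      rw [contrib, indicator_of_notMem (show S ∉ Iic s from hs'), zero_mul, mul_zero]
    · have h2 : s ∉ Ioc 0 t := fun h2 => hst h2.2
      rw [indicator_of_notMem h2, indicator_apply_eq_zero]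
      intro _
      simp only [contrib, chainStep, add_sub_cancel]
      rw [indicator_of_notMem (show s ∉ Iic t from hst), zero_mul, mul_zero]

lemma nSwitch_zero (hlam : 0 < lam) {t : ℝ} (ht : 0 ≤ t) (z : Torus × Fin 2)
    (g : Torus × Fin 2 → ℝ≥0∞) :
    nSwitch u lam t 0 z g =
      ENNReal.ofReal (Real.exp (-lam * t)) * g (flow (u z.2) t z.1, z.2) := by
  have := isProbabilityMeasure_waitingLaw hlam
  simp only [nSwitch, chain_zero, contrib, sub_zero]
  rw [indicator_of_mem (show (0 : ℝ) ∈ Iic t from ht)]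
  simp

lemma nSwitch_succ (hu : ∀ i, SmoothField (u i)) (hlam : 0 < lam) (t : ℝ) (i : Fin 2)
    {E : Set Torus} (hE : MeasurableSet E) (n : ℕ) (z : Torus × Fin 2) :
    nSwitch u lam t (n + 1) z ((E ×ˢ {i}).indicator 1) =
      ∫⁻ s in Ioc 0 t, expWeight lam (t - s) *
        nSwitch u lam s n z ((preSwitch u i E (t - s)).indicator 1) := by
  have := isProbabilityMeasure_waitingLaw hlam
  have hg : Measurable ((E ×ˢ {i}).indicator (1 : Torus × Fin 2 → ℝ≥0∞)) :=
    measurable_one.indicator (hE.prod (measurableSet_singleton i))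
  have hcon : Measurable (contrib u lam t ((E ×ˢ {i}).indicator 1)) :=
    (measurable_contrib (lam := lam) hu (G := fun p : ℝ × Torus × Fin 2 =>
      (E ×ˢ ({i} : Set (Fin 2))).indicator 1 p.2)
      (hg.comp measurable_snd)).comp (measurable_prodMk_left (x := t))
  have hH : Measurable (fun p : (ℝ × Torus × Fin 2) × ℝ =>
      contrib u lam t ((E ×ˢ {i}).indicator 1) (chainStep u p.1 p.2)) :=
    hcon.comp (measurable_chainStep hu)
  have hG := measurable_contrib (lam := lam) hu (measurable_preSwitch hu i hE t)
  have hchain : Measurable (fun τ : ℕ → ℝ => chain u z τ n) :=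
    (measurable_chain hu n).comp measurable_prodMk_left
  simp only [nSwitch, chain_succ]
  rw [lintegral_chain_waiting hu hlam z n hH]
  have h1 : ∀ᵐ τ ∂waitingLaw lam, ∫⁻ r, contrib u lam t ((E ×ˢ {i}).indicator 1)
      (chainStep u (chain u z τ n) r) ∂expMeasure lam =
      ∫⁻ s in Ioc 0 t, expWeight lam (t - s) *
        contrib u lam s ((preSwitch u i E (t - s)).indicator 1) (chain u z τ n) := by
    filter_upwards [ae_waiting_pos hlam] with τ hτ
    refine (lintegral_expMeasure (hH.comp (measurable_prodMk_left (x := chain u z τ n)))).trans ?_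
    refine lintegral_contrib_chainStep hlam t i E ?_
    have := (strictMono_switchTime hτ).monotone (Nat.zero_le n)
    rwa [switchTime_zero] at this
  rw [lintegral_congr_ae h1, lintegral_lintegral_swap]
  · refine lintegral_congr fun s => ?_
    refine lintegral_const_mul _ ?_
    exact (hG.comp measurable_prodMk_left).comp hchain
  · refine Measurable.aemeasurable ?_
    refine (measurable_expWeight.comp (measurable_const.sub measurable_snd)).mul ?_
    exact hG.comp (measurable_snd.prodMk (hchain.comp measurable_fst))

/-- The forward equation of the switching process in integrated form. -/
lemma transProb_eq (hu : ∀ i, SmoothField (u i)) (hlam : 0 < lam) {t : ℝ} (ht : 0 ≤ t)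
    (i : Fin 2) {E : Set Torus} (hE : MeasurableSet E) (z : Torus × Fin 2) :
    transProb u lam t z (E ×ˢ {i}) =
      ENNReal.ofReal (Real.exp (-lam * t)) *
        (E ×ˢ {i}).indicator 1 (flow (u z.2) t z.1, z.2) +
      ∫⁻ s in Ioc 0 t, expWeight lam (t - s) *
        ∑' n, nSwitch u lam s n z ((preSwitch u i E (t - s)).indicator 1) := by
  rw [transProb_eq_tsum hu hlam ht z (hE.prod (measurableSet_singleton i)),
    tsum_eq_zero_add' ENNReal.summable, nSwitch_zero hlam ht]
  congr 1
  simp only [nSwitch_succ hu hlam t i hE]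
  rw [← lintegral_tsum]
  · simp only [ENNReal.tsum_mul_left]
  · intro n
    refine Measurable.aemeasurable ?_
    refine (measurable_expWeight.comp (measurable_const.sub measurable_id)).mul ?_
    exact (measurable_nSwitch hu hlam (measurable_preSwitch hu i hE t) n).comp
      (measurable_id.prodMk measurable_const)

/-! ### Equations for the components of an invariant measure -/

variable {μ : Measure (Torus × Fin 2)}

lemma component_apply (i : Fin 2) {E : Set Torus} (hE : MeasurableSet E) :
    component μ i E = μ (E ×ˢ {i}) := by
  rw [component, Measure.map_apply measurable_fst hE,
    Measure.restrict_apply (measurable_fst hE)]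
  congr 1
  ext ⟨x, j⟩
  simp

lemma isFiniteMeasure_component [IsFiniteMeasure μ] (i : Fin 2) :
    IsFiniteMeasure (component μ i) := by
  unfold component
  infer_instance

/-- Integrate the forward equation against `μ`. Invariance is used twice: at time `t`, and at each
time `s`, where the sum over the number of switches is again a transition probability, now into the
set `preSwitch`. -/
lemma IsInvariant.component_eq (hu : ∀ i, SmoothField (u i)) (hlam : 0 < lam)
    (hμ : IsInvariant u lam μ) {t : ℝ} (ht : 0 ≤ t) (i : Fin 2) {E : Set Torus}
    (hE : MeasurableSet E) :
    component μ i E =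
      ENNReal.ofReal (Real.exp (-lam * t)) * component μ i (flow (u i) t ⁻¹' E) +
      ∫⁻ s in Ioc 0 t, expWeight lam (t - s) *
        component μ (1 - i) (flow (u i) (t - s) ⁻¹' E) := by
  have := hμ.1
  have hfin := fun i => isFiniteMeasure_component (μ := μ) i
  have hT : Measurable (fun p : ℝ × Torus × Fin 2 => ∑' n, nSwitch u lam p.1 n p.2
      ((preSwitch u i E (t - p.1)).indicator 1)) :=
    Measurable.tsum fun n => measurable_nSwitch hu hlam (measurable_preSwitch hu i hE t) n
  have hw : Measurable (fun s => expWeight lam (t - s)) :=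
    measurable_expWeight.comp (measurable_const.sub measurable_id)
  have hTj : ∀ j : Fin 2, Measurable (fun p : Torus × ℝ => expWeight lam (t - p.2) *
      ∑' n, nSwitch u lam p.2 n (p.1, j) ((preSwitch u i E (t - p.2)).indicator 1)) := fun j =>
    (hw.comp measurable_snd).mul
      (hT.comp (measurable_snd.prodMk (measurable_fst.prodMk measurable_const)))
  have hTs : ∀ (j : Fin 2) (s : ℝ), Measurable (fun x : Torus =>
      ∑' n, nSwitch u lam s n (x, j) ((preSwitch u i E (t - s)).indicator 1)) := fun j s =>
    hT.comp (measurable_const.prodMk (measurable_id.prodMk measurable_const))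
  rw [component_apply i hE, hμ.2 t ht E hE i]
  simp only [transProb_eq hu hlam ht i hE]
  have hsplit : ∀ j : Fin 2, ∫⁻ x, (ENNReal.ofReal (Real.exp (-lam * t)) *
        (E ×ˢ {i}).indicator 1 (flow (u j) t x, j) +
      ∫⁻ s in Ioc 0 t, expWeight lam (t - s) *
        ∑' n, nSwitch u lam s n (x, j) ((preSwitch u i E (t - s)).indicator 1)) ∂component μ j =
      ENNReal.ofReal (Real.exp (-lam * t)) *
        (if j = i then component μ i (flow (u i) t ⁻¹' E) else 0) +
      ∫⁻ s in Ioc 0 t, expWeight lam (t - s) * ∫⁻ x, ∑' n, nSwitch u lam s n (x, j)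
        ((preSwitch u i E (t - s)).indicator 1) ∂component μ j := by
    intro j
    rw [lintegral_add_right _ (hTj j).lintegral_prod_right', lintegral_const_mul' _ _
      ENNReal.ofReal_ne_top, lintegral_lintegral_swap (hTj j).aemeasurable]
    congr 2
    · split_ifs with hj
      · subst hj
        rw [← lintegral_indicator_one (measurableSet_flow_preimage hu j hE t)]
        refine lintegral_congr fun x => ?_
        by_cases hx : flow (u j) t x ∈ E
        · rw [indicator_of_mem (show x ∈ flow (u j) t ⁻¹' E from hx),
            indicator_of_mem (show (flow (u j) t x, j) ∈ E ×ˢ {j} from ⟨hx, rfl⟩)]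
          rfl
        · rw [indicator_of_notMem (show x ∉ flow (u j) t ⁻¹' E from hx),
            indicator_of_notMem fun h : (flow (u j) t x, j) ∈ E ×ˢ {j} => hx h.1]
      · simp [indicator, hj]
    · exact funext fun s => lintegral_const_mul (expWeight lam (t - s)) (hTs j s)
  rw [Finset.sum_congr rfl fun j _ => hsplit j, Finset.sum_add_distrib, ← Finset.mul_sum,
    Finset.sum_ite_eq' Finset.univ i, if_pos (Finset.mem_univ i), ← lintegral_finsetSum]
  · congr 1
    refine setLIntegral_congr_fun measurableSet_Ioc fun s hs => ?_
    have hEs := measurableSet_flow_preimage hu i hE (t - s)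
    rw [component_apply _ hEs, hμ.2 s hs.1.le _ hEs, ← Finset.mul_sum]
    congr 1
    refine Finset.sum_congr rfl fun j _ => lintegral_congr fun x => ?_
    rw [transProb_eq_tsum hu hlam hs.1.le _ (hEs.prod (measurableSet_singleton _))]
    rfl
  · intro j _
    refine hw.mul ?_
    exact Measurable.lintegral_prod_right' (f := fun p : ℝ × Torus =>
      ∑' n, nSwitch u lam p.1 n (p.2, j) ((preSwitch u i E (t - p.1)).indicator 1))
      (hT.comp (measurable_fst.prodMk (measurable_snd.prodMk measurable_const)))

/-- An invariant measure is the image of its other component under one switch. -/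
lemma IsInvariant.component_eq_lintegral (hu : ∀ i, SmoothField (u i)) (hlam : 0 < lam)
    (hμ : IsInvariant u lam μ) (i : Fin 2) {E : Set Torus} (hE : MeasurableSet E) :
    component μ i E =
      ∫⁻ r in Ioi 0, expWeight lam r * component μ (1 - i) (flow (u i) r ⁻¹' E) := by
  have := hμ.1
  have hfin := fun i => isFiniteMeasure_component (μ := μ) i
  set f : ℝ → ℝ≥0∞ := fun r => expWeight lam r * component μ (1 - i) (flow (u i) r ⁻¹' E)
  have hf : Measurable f := by
    refine measurable_expWeight.mul ?_
    exact measurable_measure_prodMk_left (ν := component μ (1 - i))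
      (s := (fun p : ℝ × Torus => flow (u i) p.1 p.2) ⁻¹' E) ((hu i).measurable_flow hE)
  have h1 : ∀ n : ℕ, component μ i E =
      ENNReal.ofReal (Real.exp (-lam * n)) * component μ i (flow (u i) n ⁻¹' E) +
      ∫⁻ r in Iic (n : ℝ), f r ∂volume.restrict (Ioi 0) := by
    intro n
    rw [hμ.component_eq hu hlam n.cast_nonneg i hE, Measure.restrict_restrict measurableSet_Iic]
    congr 1
    -- The reflection `r = n - s` does not preserve the half-open interval, so the null endpoint is
    -- added first.
    have hset : Iic (n : ℝ) ∩ Ioi 0 = Ioc 0 (n : ℝ) := by ext; simp [and_comm]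
    rw [hset, restrict_Ioc_eq_restrict_Icc,
      ← lintegral_indicator measurableSet_Icc, ← lintegral_indicator measurableSet_Icc,
      ← lintegral_sub_left_eq_self ((Icc 0 (n : ℝ)).indicator f) n]
    refine lintegral_congr fun s => ?_
    simp only [indicator, mem_Icc, f, sub_nonneg, sub_le_self_iff]
    simp only [and_comm]
  have h2 : Filter.Tendsto (fun n : ℕ => ENNReal.ofReal (Real.exp (-lam * n)) *
      component μ i (flow (u i) n ⁻¹' E)) Filter.atTop (𝓝 0) := by
    have h3 : Filter.Tendsto (fun n : ℕ => ENNReal.ofReal (Real.exp (-lam * n)) *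
        component μ i univ) Filter.atTop (𝓝 0) := by
      have h4 : Filter.Tendsto (fun n : ℕ => Real.exp (-lam * n)) Filter.atTop (𝓝 0) :=
        Real.tendsto_exp_atBot.comp
          (tendsto_natCast_atTop_atTop.const_mul_atTop_of_neg (by linarith))
      have h5 := ENNReal.tendsto_ofReal h4
      rw [ENNReal.ofReal_zero] at h5
      simpa using ENNReal.Tendsto.mul_const h5 (Or.inr (measure_ne_top (component μ i) univ))
    refine tendsto_of_tendsto_of_tendsto_of_le_of_le tendsto_const_nhds h3
      (fun _ => zero_le) fun n => ?_
    dsimp only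
    gcongr
    exact subset_univ _
  have h3 : Filter.Tendsto (fun n : ℕ => ∫⁻ r in Iic (n : ℝ), f r ∂volume.restrict (Ioi 0))
      Filter.atTop (𝓝 (∫⁻ r in Ioi 0, f r)) :=
    (aecover_Iic tendsto_natCast_atTop_atTop).lintegral_tendsto_of_countably_generated
      hf.aemeasurable
  have h4 := h2.add h3
  rw [zero_add] at h4
  exact tendsto_nhds_unique (tendsto_const_nhds.congr h1) h4

end LastSwitch

/-! ### Absolute continuity and the equations for the densities -/

section Density

open scoped NNReal ENNReal Topology

variable {u : Fin 2 → Torus → Plane} {lam : ℝ} {μ : Measure (Torus × Fin 2)}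

lemma Transversal.span_eq_top (h : Transversal u) (i : Fin 2) (x : Torus) :
    Submodule.span ℝ {u i x, u (1 - i) x} = ⊤ := by
  fin_cases i
  · exact h x
  · have := h x
    rw [Set.pair_comm] at this
    exact this

/-- For every starting point, almost every pair of times avoids `N`. Fubini exchanges the
quantifiers, so for almost every pair the double preimage of `N` is null for the component, and two
uses of the one-switch identity integrate this to zero. -/
lemma IsInvariant.absolutelyContinuous (hu : ∀ i, SmoothField (u i)) (htrans : Transversal u)
    (hlam : 0 < lam) (hμ : IsInvariant u lam μ) (i : Fin 2) : component μ i ≪ volume := by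
  have := hμ.1
  have := isFiniteMeasure_component (μ := μ) i
  refine Measure.AbsolutelyContinuous.mk fun N hN hN0 => ?_
  have hmeas : MeasurableSet {q : Torus × ℝ × ℝ |
      ¬ flow (u i) q.2.1 (flow (u (1 - i)) q.2.2 q.1) ∈ N} := by
    have h1 : Measurable (fun q : Torus × ℝ × ℝ => flow (u (1 - i)) q.2.2 q.1) :=
      (hu (1 - i)).measurable_flow.comp
        ((measurable_snd.comp measurable_snd).prodMk measurable_fst)
    have h2 : Measurable (fun q : Torus × ℝ × ℝ =>
        flow (u i) q.2.1 (flow (u (1 - i)) q.2.2 q.1)) :=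
      (hu i).measurable_flow.comp ((measurable_fst.comp measurable_snd).prodMk h1)
    exact (h2 hN).compl
  have h1 : ∀ᵐ p : ℝ × ℝ, ∀ᵐ x ∂component μ i,
      ¬ flow (u i) p.1 (flow (u (1 - i)) p.2 x) ∈ N :=
    (Measure.ae_ae_comm hmeas).1 (Filter.Eventually.of_forall fun x =>
      ae_flow_flow_notMem (hu i) (hu (1 - i)) (htrans.span_eq_top i) hN0 x)
  have h2 : ∀ᵐ r : ℝ, ∀ᵐ s : ℝ,
      component μ i (flow (u (1 - i)) s ⁻¹' (flow (u i) r ⁻¹' N)) = 0 := by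
    filter_upwards [Measure.ae_ae_of_ae_prod h1] with r hr
    filter_upwards [hr] with s hs
    exact measure_eq_zero_iff_ae_notMem.2 hs
  have h3 : ∀ᵐ r : ℝ, component μ (1 - i) (flow (u i) r ⁻¹' N) = 0 := by
    filter_upwards [h2] with r hr
    rw [hμ.component_eq_lintegral hu hlam (1 - i) (measurableSet_flow_preimage hu i hN r),
      sub_sub_cancel]
    refine (lintegral_congr_ae (ae_restrict_of_ae ?_)).trans lintegral_zero
    filter_upwards [hr] with s hs
    rw [hs, mul_zero]
  rw [hμ.component_eq_lintegral hu hlam i hN]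
  refine (lintegral_congr_ae (ae_restrict_of_ae ?_)).trans lintegral_zero
  filter_upwards [h3] with r hr
  rw [hr, mul_zero]

/-! ### Densities and their transport -/

lemma IsDensity.ae_nonneg {ν : Measure Torus} {ρ : Torus → ℝ} (h : IsDensity ν ρ) :
    ∀ᵐ x, 0 ≤ ρ x :=
  ae_nonneg_of_forall_setIntegral_nonneg h.1 fun E hE _ => by
    rw [← h.2 E hE]
    exact measureReal_nonneg

lemma IsDensity.apply_eq_setLIntegral {ν : Measure Torus} [IsFiniteMeasure ν] {ρ : Torus → ℝ}
    (h : IsDensity ν ρ) {E : Set Torus} (hE : MeasurableSet E) :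
    ν E = ∫⁻ x in E, ENNReal.ofReal (ρ x) := by
  rw [← ofReal_integral_eq_lintegral_ofReal h.1.integrableOn (ae_restrict_of_ae h.ae_nonneg),
    ← h.2 E hE, ofReal_measureReal]

/-- An arbitrary density is only almost everywhere measurable and nonnegative. Tonelli is applied to
this version, and the result is transferred back along orbits. -/
lemma IsDensity.exists_measurable {ν : Measure Torus} {ρ : Torus → ℝ} (h : IsDensity ν ρ) :
    ∃ m : Torus → ℝ, Measurable m ∧ (∀ x, 0 ≤ m x) ∧ ρ =ᵐ[volume] m := by
  obtain ⟨m, hm, hρ⟩ := h.1.1.aemeasurable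
  refine ⟨fun x => max (m x) 0, hm.max measurable_const, fun x => le_max_right _ _, ?_⟩
  filter_upwards [hρ, h.ae_nonneg] with x hx h0
  rw [← hx, max_eq_left h0]

lemma IsDensity.congr {ν : Measure Torus} {ρ m : Torus → ℝ} (h : IsDensity ν ρ)
    (hm : ρ =ᵐ[volume] m) : IsDensity ν m :=
  ⟨h.1.congr hm, fun E hE => (h.2 E hE).trans (integral_congr_ae (ae_restrict_of_ae hm))⟩

variable {v : Torus → Plane}

lemma SmoothField.invFlow_flow (hv : SmoothField v) (t : ℝ) (x : Torus) :
    invFlow v t (flow v t x) = x := by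
  have := hv.flow_invFlow (-t) x
  rwa [invFlow, neg_neg] at this

/-- Mass transport by the flow, expressed by the density. -/
lemma SmoothField.setLIntegral_flow_preimage (hv : SmoothField v) (t : ℝ) {g : Torus → ℝ≥0∞}
    (hg : Measurable g) {E : Set Torus} (hE : MeasurableSet E) :
    ∫⁻ x in flow v t ⁻¹' E, g x =
      ∫⁻ y in E, ENNReal.ofReal (dInvFlow v t y).det * g (invFlow v t y) := by
  have hE' : MeasurableSet (flow v t ⁻¹' E) :=
    (hv.measurable_flow.comp measurable_prodMk_left) hE
  have hm : Measurable (E.indicator fun y => g (invFlow v t y)) :=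
    (hg.comp (hv.measurable_invFlow.comp measurable_prodMk_left)).indicator hE
  have h := hv.lintegral_flow t hm
  rw [← lintegral_indicator hE', ← lintegral_indicator hE]
  convert h using 1
  · refine lintegral_congr fun x => ?_
    by_cases hx : flow v t x ∈ E
    · rw [indicator_of_mem hx, indicator_of_mem (show x ∈ flow v t ⁻¹' E from hx),
        hv.invFlow_flow]
    · rw [indicator_of_notMem hx, indicator_of_notMem (show x ∉ flow v t ⁻¹' E from hx)]
  · refine lintegral_congr fun y => ?_
    by_cases hy : y ∈ E
    · rw [indicator_of_mem hy, indicator_of_mem hy]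
    · rw [indicator_of_notMem hy, indicator_of_notMem hy, mul_zero]

/-- The one-switch equation in extended nonnegative form. -/
lemma IsInvariant.ae_ofReal_eq_lintegral (hu : ∀ i, SmoothField (u i)) (hlam : 0 < lam)
    (hμ : IsInvariant u lam μ) {m : Fin 2 → Torus → ℝ} (hm : ∀ i, Measurable (m i))
    (hd : ∀ i, IsDensity (component μ i) (m i)) (i : Fin 2) :
    ∀ᵐ x, ENNReal.ofReal (m i x) = ∫⁻ t in Ioi (0 : ℝ), expWeight lam t *
      (ENNReal.ofReal (dInvFlow (u i) t x).det *
        ENNReal.ofReal (m (1 - i) (invFlow (u i) t x))) := by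
  have := hμ.1
  have hfin := fun i => isFiniteMeasure_component (μ := μ) i
  have hg : Measurable (fun p : Torus × ℝ => expWeight lam p.2 *
      (ENNReal.ofReal (dInvFlow (u i) p.2 p.1).det *
        ENNReal.ofReal (m (1 - i) (invFlow (u i) p.2 p.1)))) := by
    refine (measurable_expWeight.comp measurable_snd).mul (Measurable.fun_mul ?_ ?_)
    · exact ((hu i).measurable_det_dInvFlow.comp measurable_swap).ennreal_ofReal
    · exact ((hm (1 - i)).comp ((hu i).measurable_invFlow.comp measurable_swap)).ennreal_ofReal
  -- Both sides are tested on measurable `E`; Tonelli then moves the time integral outside, where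
  -- the change of variables applies for each fixed time.
  refine ae_eq_of_forall_setLIntegral_eq_of_sigmaFinite (hm i).ennreal_ofReal
    hg.lintegral_prod_right' fun E hE _ => ?_
  rw [← (hd i).apply_eq_setLIntegral hE, hμ.component_eq_lintegral hu hlam i hE,
    lintegral_lintegral_swap hg.aemeasurable]
  refine lintegral_congr fun t => ?_
  rw [lintegral_const_mul, (hd (1 - i)).apply_eq_setLIntegral (measurableSet_flow_preimage hu i hE t),
    (hu i).setLIntegral_flow_preimage t (hm (1 - i)).ennreal_ofReal hE]
  refine Measurable.fun_mul ?_ ?_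
  · exact ((hu i).measurable_det_dInvFlow.comp measurable_prodMk_left).ennreal_ofReal
  · exact ((hm (1 - i)).comp
      ((hu i).measurable_invFlow.comp measurable_prodMk_left)).ennreal_ofReal

lemma exists_measurableSet_null {p : Torus → Prop} (hp : ∀ᵐ x, p x) :
    ∃ N : Set Torus, MeasurableSet N ∧ volume N = 0 ∧ ∀ x ∉ N, p x := by
  refine ⟨toMeasurable volume {x | ¬ p x}, measurableSet_toMeasurable _ _, ?_, fun x hx => ?_⟩
  · rw [measure_toMeasurable]; exact hp
  · by_contra h
    exact hx (subset_toMeasurable _ _ h)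

/-- Each inverse flow map respects null sets, so Fubini makes the property hold at almost all times
along almost every orbit. This permits changing a density on a null set inside the time integrals.
-/
lemma SmoothField.ae_ae_invFlow (hv : SmoothField v) {p : Torus → Prop} (hp : ∀ᵐ x, p x) :
    ∀ᵐ x, ∀ᵐ t : ℝ, p (invFlow v t x) := by
  obtain ⟨N, hN, hN0, hNp⟩ := exists_measurableSet_null hp
  have hmeas : MeasurableSet {q : ℝ × Torus | invFlow v q.1 q.2 ∉ N} :=
    (hv.measurable_invFlow hN).compl
  have h := (Measure.ae_ae_comm (μ := volume) (ν := volume) hmeas).1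
    (Filter.Eventually.of_forall fun t => hv.ae_invFlow t (measure_eq_zero_iff_ae_notMem.1 hN0))
  filter_upwards [h] with x hx
  filter_upwards [hx] with t ht
  exact hNp _ ht

lemma measurable_invFlow₂ (hu : ∀ i, SmoothField (u i)) (x : Torus) :
    Measurable (fun p : ℝ × ℝ => invFlow₂ u p.1 p.2 x) :=
  (hu 1).measurable_invFlow.comp (measurable_fst.prodMk
    ((hu 0).measurable_invFlow.comp (measurable_snd.prodMk measurable_const)))

lemma ae_ae_invFlow₂ (hu : ∀ i, SmoothField (u i)) {p : Torus → Prop} (hp : ∀ᵐ x, p x) :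
    ∀ᵐ x, ∀ᵐ q : ℝ × ℝ, p (invFlow₂ u q.1 q.2 x) := by
  obtain ⟨N, hN, hN0, hNp⟩ := exists_measurableSet_null hp
  have h1 : ∀ᵐ y : Torus, ∀ᵐ s : ℝ, invFlow (u 1) s y ∉ N :=
    (hu 1).ae_ae_invFlow (measure_eq_zero_iff_ae_notMem.1 hN0)
  filter_upwards [(hu 0).ae_ae_invFlow h1] with x hx
  have hmeas : MeasurableSet {q : ℝ × ℝ | invFlow₂ u q.1 q.2 x ∉ N} :=
    (measurable_invFlow₂ hu x hN).compl
  have h2 : ∀ᵐ q ∂(volume : Measure ℝ).prod volume, invFlow₂ u q.1 q.2 x ∉ N := by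
    rw [Measure.ae_prod_iff_ae_ae hmeas]
    exact (Measure.ae_ae_comm (p := fun s t => invFlow₂ u s t x ∉ N) hmeas).2 hx
  filter_upwards [h2] with q hq
  exact hNp _ hq

/-- The left side is a real number, so the lower integral is finite and integrability comes for
free. -/
lemma integrable_and_eq_integral_of_lintegral {α : Type*} [MeasurableSpace α] {κ : Measure α}
    {f g : α → ℝ} {c : ℝ} (hg : Measurable g) (hfg : f =ᵐ[κ] g) (hg0 : 0 ≤ᵐ[κ] g) (hc : 0 ≤ c)
    (h : ENNReal.ofReal c = ∫⁻ a, ENNReal.ofReal (g a) ∂κ) :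
    Integrable f κ ∧ c = ∫ a, f a ∂κ := by
  have hi : Integrable g κ := by
    refine ⟨hg.aestronglyMeasurable, ?_⟩
    rw [hasFiniteIntegral_iff_ofReal hg0, ← h]
    exact ENNReal.ofReal_lt_top
  refine ⟨hi.congr hfg.symm, ?_⟩
  rw [integral_congr_ae hfg, integral_eq_lintegral_of_nonneg_ae hg0 hg.aestronglyMeasurable, ← h,
    ENNReal.toReal_ofReal hc]

variable {ρ : Fin 2 → Torus → ℝ}

lemma IsInvariant.ae_eq_oneSwitch (hu : ∀ i, SmoothField (u i)) (hlam : 0 < lam)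
    (hμ : IsInvariant u lam μ) (hρ : ∀ i, IsDensity (component μ i) (ρ i)) (i : Fin 2) :
    ∀ᵐ x, IntegrableOn (oneSwitchIntegrand u lam i (ρ (1 - i)) x) (Ioi 0) ∧
      ρ i x = ∫ t in Ioi (0 : ℝ), oneSwitchIntegrand u lam i (ρ (1 - i)) x t := by
  choose m hm hm0 hρm using fun i => (hρ i).exists_measurable
  have hd : ∀ i, IsDensity (component μ i) (m i) := fun i => (hρ i).congr (hρm i)
  filter_upwards [hμ.ae_ofReal_eq_lintegral hu hlam hm hd i, hρm i,
    (hu i).ae_ae_invFlow (hρm (1 - i))] with x hx hρx hρt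
  rw [hρx]
  have hdet : Measurable (fun t => (dInvFlow (u i) t x).det) :=
    (hu i).measurable_det_dInvFlow.comp (measurable_id.prodMk measurable_const)
  have hmi : Measurable (fun t => m (1 - i) (invFlow (u i) t x)) :=
    (hm (1 - i)).comp ((hu i).measurable_invFlow.comp (measurable_id.prodMk measurable_const))
  refine integrable_and_eq_integral_of_lintegral (g := oneSwitchIntegrand u lam i (m (1 - i)) x)
    ?_ ?_ ?_ (hm0 i x) ?_
  · unfold oneSwitchIntegrand
    exact ((by fun_prop : Measurable fun t : ℝ => lam * Real.exp (-lam * t)).mul hdet).mul hmi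
  · refine ae_restrict_of_ae ?_
    filter_upwards [hρt] with t ht
    rw [oneSwitchIntegrand, oneSwitchIntegrand, ht]
  · refine Filter.Eventually.of_forall fun t => ?_
    have := ((hu i).det_dInvFlow_pos t x).le
    have := hm0 (1 - i) (invFlow (u i) t x)
    simp only [oneSwitchIntegrand, Pi.zero_apply]
    positivity
  · rw [hx]
    refine lintegral_congr fun t => ?_
    have := ((hu i).det_dInvFlow_pos t x).le
    rw [oneSwitchIntegrand, ENNReal.ofReal_mul (by positivity), ENNReal.ofReal_mul (by positivity),
      expWeight, mul_assoc]

/-- The equation for index `1`, valid at `invFlow (u 0) t x` for almost every `t`, is inserted into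
the equation for index `0`; the product of the two determinants is `jac`. -/
lemma IsInvariant.ae_eq_Q (hu : ∀ i, SmoothField (u i)) (hlam : 0 < lam)
    (hμ : IsInvariant u lam μ) (hρ : ∀ i, IsDensity (component μ i) (ρ i)) :
    ∀ᵐ x, IntegrableOn (QIntegrand u lam (ρ 0) x) (Ioi 0 ×ˢ Ioi 0) ∧
      ρ 0 x = Q u lam (ρ 0) x := by
  choose m hm hm0 hρm using fun i => (hρ i).exists_measurable
  have hd : ∀ i, IsDensity (component μ i) (m i) := fun i => (hρ i).congr (hρm i)
  filter_upwards [hμ.ae_ofReal_eq_lintegral hu hlam hm hd 0, hρm 0,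
    (hu 0).ae_ae_invFlow (hμ.ae_ofReal_eq_lintegral hu hlam hm hd 1),
    ae_ae_invFlow₂ hu (hρm 0)] with x hx hρx hx1 hρ2
  rw [Q, hρx]
  have hdet0 : Measurable (fun p : ℝ × ℝ => (dInvFlow (u 0) p.2 x).det) :=
    (hu 0).measurable_det_dInvFlow.comp (measurable_snd.prodMk measurable_const)
  have hdet1 : Measurable (fun p : ℝ × ℝ => (dInvFlow (u 1) p.1 (invFlow (u 0) p.2 x)).det) :=
    (hu 1).measurable_det_dInvFlow.comp (measurable_fst.prodMk
      ((hu 0).measurable_invFlow.comp (measurable_snd.prodMk measurable_const)))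
  have hmi : Measurable (fun p : ℝ × ℝ => m 0 (invFlow₂ u p.1 p.2 x)) :=
    (hm 0).comp (measurable_invFlow₂ hu x)
  have hQ : Measurable (QIntegrand u lam (m 0) x) := by
    unfold QIntegrand
    simp only [jac_eq]
    exact ((by fun_prop : Measurable fun p : ℝ × ℝ =>
      lam ^ 2 * Real.exp (-lam * (p.1 + p.2))).mul (hdet1.mul hdet0)).mul hmi
  have hjac : ∀ p : ℝ × ℝ, 0 ≤ jac u p.1 p.2 x := fun p => by
    rw [jac_eq]
    exact (mul_pos ((hu 1).det_dInvFlow_pos _ _) ((hu 0).det_dInvFlow_pos _ _)).le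
  refine integrable_and_eq_integral_of_lintegral hQ ?_ ?_ (hm0 0 x) ?_
  · refine ae_restrict_of_ae ?_
    filter_upwards [hρ2] with p hp
    rw [QIntegrand, QIntegrand, hp]
  · refine Filter.Eventually.of_forall fun p => ?_
    have := hjac p
    have := hm0 0 (invFlow₂ u p.1 p.2 x)
    simp only [QIntegrand, Pi.zero_apply]
    positivity
  -- In `p = (s, t)` the outer variable is the second one, hence the symmetric form of Tonelli.
  · rw [hx, show (volume : Measure (ℝ × ℝ)) = (volume : Measure ℝ).prod volume from rfl,
      ← Measure.prod_restrict, lintegral_prod_symm' _ hQ.ennreal_ofReal]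
    refine lintegral_congr_ae (ae_restrict_of_ae ?_)
    filter_upwards [hx1] with t ht
    rw [show (1 : Fin 2) - 0 = 1 from rfl, ht, show (1 : Fin 2) - 1 = 0 from rfl, ← mul_assoc,
      ← lintegral_const_mul]
    · refine lintegral_congr fun s => ?_
      have h0 := ((hu 0).det_dInvFlow_pos t x).le
      have h1 := ((hu 1).det_dInvFlow_pos s (invFlow (u 0) t x)).le
      have h2 := hm0 0 (invFlow (u 1) s (invFlow (u 0) t x))
      rw [expWeight, expWeight, ← ENNReal.ofReal_mul (by positivity), ← ENNReal.ofReal_mul h1,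
        ← ENNReal.ofReal_mul (by positivity), ← ENNReal.ofReal_mul (by positivity)]
      congr 1
      simp only [QIntegrand, jac_eq, invFlow₂]
      rw [show -lam * (s + t) = -lam * t + -lam * s by ring, Real.exp_add]
      ring
    · refine measurable_expWeight.mul (Measurable.fun_mul ?_ ?_)
      · exact (hdet1.comp (measurable_id.prodMk (measurable_const (a := t)))).ennreal_ofReal
      · exact (hmi.comp (measurable_id.prodMk (measurable_const (a := t)))).ennreal_ofReal

end Density

end Switching

end

theorem mainTheorem8 (u : Fin 2 → Switching.Torus → Switching.Plane)
    (hu : ∀ i, Switching.SmoothField (u i)) (htrans : Switching.Transversal u)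
    (lam : ℝ) (hlam : 0 < lam)
    (μ : Measure (Switching.Torus × Fin 2)) (hμ : Switching.IsInvariant u lam μ) :
    (∀ i, Switching.component μ i ≪ volume) ∧
    ∀ ρ : Fin 2 → Switching.Torus → ℝ,
      (∀ i, Switching.IsDensity (Switching.component μ i) (ρ i)) →
      (∀ i, ∀ᵐ x ∂(volume : Measure Switching.Torus),
        IntegrableOn (Switching.oneSwitchIntegrand u lam i (ρ (1 - i)) x) (Ioi 0) ∧
        ρ i x = ∫ t in Ioi (0 : ℝ), Switching.oneSwitchIntegrand u lam i (ρ (1 - i)) x t) ∧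
      (∀ᵐ x ∂(volume : Measure Switching.Torus),
        IntegrableOn (Switching.QIntegrand u lam (ρ 0) x) (Ioi 0 ×ˢ Ioi 0) ∧
        ρ 0 x = Switching.Q u lam (ρ 0) x) := by
  exact ⟨fun i => hμ.absolutelyContinuous hu htrans hlam i, fun ρ hρ =>
    ⟨fun i => hμ.ae_eq_oneSwitch hu hlam hρ i, hμ.ae_eq_Q hu hlam hρ⟩⟩
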